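/- Let $p$ be a prime, let $dx$ be the Haar measure on $\mathbb{Q}_p$ with $\int_{|x|_p\le 1}dx=1$, and let $\alpha>0$, $0<\gamma<\min(1,\alpha)$, $u_0\in\mathbb{R}$. For real functions $\varphi$ on $\mathbb{Q}_p$ put $$(D^{\alpha}\varphi)(t)=\frac{1-p^{\alpha}}{1-p^{-\alpha-1}}\int_{\mathbb{Q}_p}|y|_p^{-\alpha-1}\,[\varphi(t-y)-\varphi(t)]\,dy,$$ $$(I^{\alpha}\varphi)(x)=c_\alpha\int_{|y|_p\le|x|_p}\big(k_\alpha(|x-y|_p)-k_\alpha(|y|_p)\big)\varphi(y)\,dy,$$ where $k_\alpha(r)=r^{\alpha-1}$, $c_\alpha=\frac{1-p^{-\alpha}}{1-p^{\alpha-1}}$ if $\alpha\ne1$, and $k_1(r)=\log r$, $c_1=\frac{1-p}{p\log p}$; such an operator is said to exist at a point if the integral converges absolutely there. Let $f:p^{\mathbb{Z}}\times\mathbb{R}\to\mathbb{R}$ satisfy, for some real constants $M$, $A$, $\beta$, $F_\ell$, * $|f(p^{\ell},x)|\le M$ for all $\ell\in\mathbb{Z}$, $x\in\mathbb{R}$;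 * $|f(p^{\ell},x)-f(p^{\ell},y)|\le F_\ell|x-y|$ for all $\ell\in\mathbb{Z}$, $x,y\in\mathbb{R}$, where $0<F_\ell<p^{-\alpha\ell}$; * $|f(p^{\ell},x)|\le A\,p^{-\beta\ell}$ for all integers $\ell\ge1$ and $x\in\mathbb{R}$, where $\beta+\gamma>\alpha$. Write $\widetilde f(r,x)=r^{-\gamma}f(r,x)$ and consider the integral equation $$u(|t|_p)=u_0+I^{\alpha}\big[\widetilde f(|\cdot|_p,u(|\cdot|_p))\big](|t|_p).\qquad(*)$$ A function $u=u(|t|_p)$ on $\mathbb{Q}_p$ is said to be obtained by iteration with subsequent continuation if for some $N\in\mathbb{Z}$ it is, on the ball $|t|_p\le p^N$, the uniform limit of the successive approximations $u_0$, $u_{k+1}=u_0+I^{\alpha}[\widetilde f(|\cdot|_p,u_k)]$, and for every integer $\ell\ge N$ its value on the sphere $|t|_p=p^{\ell+1}$ satisfies $$u(p^{\ell+1})=u_0+v_0^{(\ell)}+p^{\alpha\ell}\widetilde f(p^{\ell+1},u(p^{\ell+1})),\quad v_0^{(\ell)}=c_\alpha\int_{|y|_p\le p^{\ell}}\big(k_\alpha(p^{\ell+1})-k_\alpha(|y|_p)\big)\widetilde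 f(|y|_p,u(|y|_p))\,dy.$$ Then every such $u$ is a solution of $(*)$ on all of $\mathbb{Q}_p$ (with the integral existing at every point), $u(0)=u_0$, and for every $0\ne t\in\mathbb{Q}_p$ the value $(D^{\alpha}u)(|t|_p)$ exists and $$|t|_p^{\gamma}\,(D^{\alpha}u)(|t|_p)=f(|t|_p,u(|t|_p)).$$ Moreover, if in addition $|f(p^{\ell},x)-f(p^{\ell},y)|\le F|x-y|$ for all $\ell\in\mathbb{Z}$, $x,y\in\mathbb{R}$, with a constant $F$ independent of $\ell$, then such a $u$ exists. -/

import Mathlib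

namespace PadicRadial

open MeasureTheory Filter

noncomputable section

/-- The Borel σ-algebra on `ℚ_p`. -/
instance instMeasurableSpacePadic (p : ℕ) [Fact p.Prime] : MeasurableSpace ℚ_[p] := borel _

instance instBorelSpacePadic (p : ℕ) [Fact p.Prime] : BorelSpace ℚ_[p] := ⟨rfl⟩

/-- The closed unit ball `{x : |x|_p ≤ 1}` as a compact set with nonempty interior. -/
def unitBall (p : ℕ) [Fact p.Prime] : TopologicalSpace.PositiveCompacts ℚ_[p] where
  carrier := Metric.closedBall 0 1
  isCompact' := isCompact_closedBall 0 1
  interior_nonempty' :=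
    ⟨0, Metric.ball_subset_interior_closedBall (Metric.mem_ball_self one_pos)⟩

/-- The Haar measure `dx` on `ℚ_p`, normalized by giving the unit ball measure `1`. -/
def haar (p : ℕ) [Fact p.Prime] : Measure ℚ_[p] := Measure.addHaarMeasure (unitBall p)

variable {p : ℕ} [Fact p.Prime]

/-- Functions of `|t|_p`. -/
def IsRadial (u : ℚ_[p] → ℝ) : Prop := ∀ s t : ℚ_[p], ‖s‖ = ‖t‖ → u s = u t

/-- The integrand `|y|_p^{-α-1} (φ(t - y) - φ(t))` of the Vladimirov operator. -/
def vladimirovIntegrand (α : ℝ) (φ : ℚ_[p] → ℝ) (t y : ℚ_[p]) : ℝ :=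
  ‖y‖ ^ (-α - 1) * (φ (t - y) - φ t)

/-- `(D^α φ)(t)` exists: the (Lebesgue) integral defining it converges. -/
def VladimirovExistsAt (α : ℝ) (φ : ℚ_[p] → ℝ) (t : ℚ_[p]) : Prop :=
  Integrable (vladimirovIntegrand α φ t) (haar p)

/-- The Vladimirov operator
`(D^α φ)(t) = (1 - p^α) / (1 - p^{-α-1}) ∫_{ℚ_p} |y|_p^{-α-1} (φ(t - y) - φ(t)) dy`. -/
def vladimirov (α : ℝ) (φ : ℚ_[p] → ℝ) (t : ℚ_[p]) : ℝ :=
  (1 - (p : ℝ) ^ α) / (1 - (p : ℝ) ^ (-α - 1)) * ∫ y, vladimirovIntegrand α φ t y ∂(haar p)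

/-- The constant in front of the fractional integral `I^α`. -/
def fracConst (p : ℕ) (α : ℝ) : ℝ :=
  if α = 1 then (1 - (p : ℝ)) / (p * Real.log p)
  else (1 - (p : ℝ) ^ (-α)) / (1 - (p : ℝ) ^ (α - 1))

/-- The one-variable kernel: `r ↦ r^{α-1}`, replaced by `r ↦ log r` if `α = 1`. -/
def fracKernel (α r : ℝ) : ℝ := if α = 1 then Real.log r else r ^ (α - 1)

/-- The integrand of `I^α`: for `α ≠ 1` it is `(|x - y|_p^{α-1} - |y|_p^{α-1}) φ(y)`,
and for `α = 1` it is `(log |x - y|_p - log |y|_p) φ(y)`. -/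
def fracIntegrand (α : ℝ) (φ : ℚ_[p] → ℝ) (x y : ℚ_[p]) : ℝ :=
  (fracKernel α ‖x - y‖ - fracKernel α ‖y‖) * φ y

/-- `(I^α φ)(x)` exists: the (Lebesgue) integral over `{|y|_p ≤ |x|_p}` converges. -/
def FracIntegralExistsAt (α : ℝ) (φ : ℚ_[p] → ℝ) (x : ℚ_[p]) : Prop :=
  IntegrableOn (fracIntegrand α φ x) {y | ‖y‖ ≤ ‖x‖} (haar p)

/-- The `p`-adic fractional integral `I^α`. -/
def fracIntegral (α : ℝ) (φ : ℚ_[p] → ℝ) (x : ℚ_[p]) : ℝ :=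
  fracConst p α * ∫ y in {y : ℚ_[p] | ‖y‖ ≤ ‖x‖}, fracIntegrand α φ x y ∂(haar p)

/-- `y ↦ |y|_p^{-γ} f(|y|_p, u(y))`. -/
def fTilde (γ : ℝ) (f : ℝ → ℝ → ℝ) (u : ℚ_[p] → ℝ) (y : ℚ_[p]) : ℝ :=
  ‖y‖ ^ (-γ) * f ‖y‖ (u y)

/-- `u` is a global solution, depending on `|t|_p` only, of the integral equation
`u = u₀ + I^α [|·|_p^{-γ} f(|·|_p, u)]` on `ℚ_p`. -/
def IsGlobalMildSolution (α γ : ℝ) (f : ℝ → ℝ → ℝ) (u₀ : ℝ) (u : ℚ_[p] → ℝ) : Prop :=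
  IsRadial u ∧ ∀ t : ℚ_[p],
    FracIntegralExistsAt α (fTilde γ f u) t ∧ u t = u₀ + fracIntegral α (fTilde γ f u) t

/-- Successive approximations: the `0`-th one is the constant `u₀`, and the next one after `v`
is `u₀ + I^α [|·|_p^{-γ} f(|·|_p, v)]`. -/
def picard (p : ℕ) [Fact p.Prime] (α γ : ℝ) (f : ℝ → ℝ → ℝ) (u₀ : ℝ) : ℕ → ℚ_[p] → ℝ
  | 0 => fun _ => u₀
  | k + 1 => fun t => u₀ + fracIntegral α (fTilde γ f (picard p α γ f u₀ k)) t

/-- The number `v₀^{(ℓ)}`, which is determined by the values of `u` on the ball `|y|_p ≤ p^ℓ`: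
the constant of `I^α` times
`∫_{|y|_p ≤ p^ℓ} (p^{(ℓ+1)(α-1)} - |y|_p^{α-1}) |y|_p^{-γ} f(|y|_p, u(y)) dy`
(with logarithms instead of powers if `α = 1`). -/
def contConst (α γ : ℝ) (f : ℝ → ℝ → ℝ) (u : ℚ_[p] → ℝ) (ℓ : ℤ) : ℝ :=
  fracConst p α * ∫ y in {y : ℚ_[p] | ‖y‖ ≤ (p : ℝ) ^ ℓ},
    (fracKernel α ((p : ℝ) ^ (ℓ + 1)) - fracKernel α ‖y‖) * fTilde γ f u y ∂(haar p)

/-- `u = u(|t|_p)` is obtained by iteration with subsequent continuation: on some ball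
`|t|_p ≤ p^N` it is the uniform limit of the successive approximations, and, for
`ℓ = N, N + 1, …`, its value on the sphere `|t|_p = p^{ℓ+1}` is found from its values on the
ball `|t|_p ≤ p^ℓ` as a root of
`u(p^{ℓ+1}) = u₀ + v₀^{(ℓ)} + p^{αℓ} (p^{ℓ+1})^{-γ} f(p^{ℓ+1}, u(p^{ℓ+1}))`. -/
def IsObtainedByIterationAndContinuation (α γ : ℝ) (f : ℝ → ℝ → ℝ) (u₀ : ℝ)
    (u : ℚ_[p] → ℝ) : Prop :=
  IsRadial u ∧ ∃ N : ℤ,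
    TendstoUniformlyOn (picard p α γ f u₀) u atTop {t : ℚ_[p] | ‖t‖ ≤ (p : ℝ) ^ N} ∧
    ∀ ℓ : ℤ, N ≤ ℓ → ∀ t : ℚ_[p], ‖t‖ = (p : ℝ) ^ (ℓ + 1) →
      u t = u₀ + contConst α γ f u ℓ + (p : ℝ) ^ (α * (ℓ : ℝ)) * fTilde γ f u t

end

end PadicRadial

namespace PadicRadial

open MeasureTheory Filter Topology

noncomputable section

variable {p : ℕ} [hp : Fact p.Prime]

/-! The ultrametric inequality turns the nonlocal operators into recursions over spheres. For a
radial source with `|φ(y)| ≤ M|y|^{-γ}`, the only contribution to `I^α φ` at `|t| = p^{n+1}` in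
which `|t - y|` varies comes from the outermost sphere, where `φ` is constant. That contribution is
`p^{αn} φ(t)`, and the rest is an integral over the ball of radius `p^n` (`fracIntegral_eq`). The
continuation equation is therefore the integral equation itself, sphere by sphere. On the starting
ball, the integral equation follows from the recursion for the successive approximations by
dominated convergence (`IsObtainedByIterationAndContinuation.eq`).

To invert `I^α`, split `D^α u(t)` at `|y| = |t|`. The increments of `u` between consecutive spheres
are explicit in `φ` and its ball integrals (`RadialSolution.sub_succ`), so each half minus its
conjectured value is independent of the radius `p^n`. It is also `O(p^{ne})` over all `n ∈ ℤ` with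
`e ≠ 0`, hence zero (`eq_zero_of_invariant_of_abs_le`). Adding the halves
(`RadialSolution.ball_integral_eq`, `RadialSolution.tail_integral_eq`) cancels the ball integrals of
`φ` and leaves `φ(t)`. This replaces the summation of double series, and the same device evaluates
`I^α` of a constant.

For existence, `|I^α φ(t)| ≤ C M |t|^{α-γ}` with `α > γ` makes the iteration a contraction on a
small ball. Each later sphere requires a root of a scalar equation with bounded continuous
nonlinearity, which the intermediate value theorem supplies. -/

theorem prime_pos : (0 : ℝ) < p := by exact_mod_cast hp.out.pos

theorem one_lt_prime : (1 : ℝ) < p := by exact_mod_cast hp.out.one_lt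

/-! ### Balls, spheres and their Haar measure. -/

instance : (haar p).IsAddHaarMeasure := by unfold haar; infer_instance

/-- The closed ball `{y : |y|_p ≤ p ^ n}`. -/
def pBall (p : ℕ) [Fact p.Prime] (n : ℤ) : Set ℚ_[p] := {y | ‖y‖ ≤ (p : ℝ) ^ n}

/-- The sphere `{y : |y|_p = p ^ n}`. -/
def pSphere (p : ℕ) [Fact p.Prime] (n : ℤ) : Set ℚ_[p] := {y | ‖y‖ = (p : ℝ) ^ n}

theorem mem_pBall {n : ℤ} {y : ℚ_[p]} : y ∈ pBall p n ↔ ‖y‖ ≤ (p : ℝ) ^ n := Iff.rfl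

theorem mem_pSphere {n : ℤ} {y : ℚ_[p]} : y ∈ pSphere p n ↔ ‖y‖ = (p : ℝ) ^ n := Iff.rfl

theorem measurableSet_pBall (n : ℤ) : MeasurableSet (pBall p n) :=
  (isClosed_le continuous_norm continuous_const).measurableSet

theorem measurableSet_pSphere (n : ℤ) : MeasurableSet (pSphere p n) :=
  (isClosed_eq continuous_norm continuous_const).measurableSet

theorem norm_lt_zpow_succ {n : ℤ} {y : ℚ_[p]} : ‖y‖ < (p : ℝ) ^ (n + 1) ↔ ‖y‖ ≤ (p : ℝ) ^ n :=
  (Padic.norm_le_pow_iff_norm_lt_pow_add_one y n).symm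

theorem exists_norm_eq_zpow {y : ℚ_[p]} (hy : y ≠ 0) : ∃ n : ℤ, ‖y‖ = (p : ℝ) ^ n :=
  ⟨_, Padic.norm_eq_zpow_neg_valuation hy⟩

/-- An element of `ℚ_p` of absolute value `p ^ n`. -/
def rep (p : ℕ) [Fact p.Prime] (n : ℤ) : ℚ_[p] := (p : ℚ_[p]) ^ (-n)

theorem norm_rep (n : ℤ) : ‖rep p n‖ = (p : ℝ) ^ n := by simp [rep]

theorem zpow_le_zpow_iff_prime {m n : ℤ} : (p : ℝ) ^ m ≤ (p : ℝ) ^ n ↔ m ≤ n :=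
  zpow_le_zpow_iff_right₀ one_lt_prime

theorem zpow_inj_prime {m n : ℤ} (h : (p : ℝ) ^ m = (p : ℝ) ^ n) : m = n :=
  zpow_right_injective₀ prime_pos one_lt_prime.ne' h

theorem pBall_succ (n : ℤ) : pBall p (n + 1) = pBall p n ∪ pSphere p (n + 1) := by
  ext y
  simp only [Set.mem_union, mem_pBall, mem_pSphere, ← norm_lt_zpow_succ (n := n)]
  exact le_iff_lt_or_eq

theorem disjoint_pBall_pSphere (n : ℤ) : Disjoint (pBall p n) (pSphere p (n + 1)) := by
  rw [Set.disjoint_left]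
  intro y hy hy'
  exact (norm_lt_zpow_succ.2 hy).ne hy'

theorem pSphere_subset_pBall (n : ℤ) : pSphere p n ⊆ pBall p n := fun _ h => le_of_eq h

theorem isCompact_pBall (n : ℤ) : IsCompact (pBall p n) := by
  have : pBall p n = Metric.closedBall 0 ((p : ℝ) ^ n) := by
    ext y; simp [mem_pBall]
  rw [this]; exact isCompact_closedBall _ _

theorem haar_pBall_lt_top (n : ℤ) : haar p (pBall p n) < ⊤ := (isCompact_pBall n).measure_lt_top

theorem haar_pSphere_lt_top (n : ℤ) : haar p (pSphere p n) < ⊤ :=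
  (measure_mono (pSphere_subset_pBall n)).trans_lt (haar_pBall_lt_top n)

/-- The larger ball splits into `p` disjoint translates of the smaller one, indexed by the leading
`p`-adic digit of `y / rep p (n + 1)`. -/
theorem haar_pBall_succ (n : ℤ) : haar p (pBall p (n + 1)) = p * haar p (pBall p n) := by
  have hc : ‖rep p (n + 1)‖ = (p : ℝ) ^ (n + 1) := norm_rep _
  have hc0 : rep p (n + 1) ≠ 0 := by
    rw [← norm_ne_zero_iff, hc]; exact (zpow_pos prime_pos _).ne'
  have hun : pBall p (n + 1) =
      ⋃ i ∈ Finset.range p, (fun y => y - (i : ℚ_[p]) * rep p (n + 1)) ⁻¹' pBall p n := by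
    ext y
    simp only [Set.mem_iUnion, Set.mem_preimage, mem_pBall, Finset.mem_range, exists_prop]
    constructor
    · intro hy
      have hz : ‖y / rep p (n + 1)‖ ≤ 1 := by
        rw [norm_div, hc]; exact div_le_one_of_le₀ hy (zpow_pos prime_pos _).le
      refine ⟨PadicInt.zmodRepr ⟨_, hz⟩, PadicInt.zmodRepr_lt_p _, ?_⟩
      have := PadicInt.norm_sub_zmodRepr_lt_one (⟨_, hz⟩ : ℤ_[p])
      rw [PadicInt.norm_def] at this
      rw [← norm_lt_zpow_succ, ← hc]
      calc _ = ‖y / rep p (n + 1) - PadicInt.zmodRepr ⟨_, hz⟩‖ * ‖rep p (n + 1)‖ := by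
            rw [← norm_mul]; congr 1; field_simp
        _ < 1 * ‖rep p (n + 1)‖ := by
            exact mul_lt_mul_of_pos_right this (norm_pos_iff.2 hc0)
        _ = _ := one_mul _
    · rintro ⟨i, -, hi⟩
      have h1 : ‖(i : ℚ_[p]) * rep p (n + 1)‖ ≤ (p : ℝ) ^ (n + 1) := by
        rw [norm_mul, hc]
        exact mul_le_of_le_one_left (zpow_pos prime_pos _).le (by
          simpa using Padic.norm_int_le_one (p := p) i)
      have h2 := Padic.nonarchimedean (y - (i : ℚ_[p]) * rep p (n + 1))
        ((i : ℚ_[p]) * rep p (n + 1))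
      rw [sub_add_cancel] at h2
      exact h2.trans (max_le (norm_lt_zpow_succ.2 hi).le h1)
  rw [hun, measure_biUnion_finset]
  · have : ∀ i ∈ Finset.range p,
        haar p ((fun y => y - (i : ℚ_[p]) * rep p (n + 1)) ⁻¹' pBall p n) =
          haar p (pBall p n) := by
      intro i _
      simp only [sub_eq_add_neg]
      exact measure_preimage_add_right _ _ _
    rw [Finset.sum_congr rfl this]; simp
  · intro i hi j hj hij
    simp only [Function.onFun]
    rw [Set.disjoint_left]
    intro y hy hy'
    simp only [Set.mem_preimage, mem_pBall, ← norm_lt_zpow_succ] at hy hy'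
    have h2 := Padic.nonarchimedean (y - (i : ℚ_[p]) * rep p (n + 1))
        (-(y - (j : ℚ_[p]) * rep p (n + 1)))
    rw [norm_neg] at h2
    have h3 := h2.trans_lt (max_lt hy hy')
    have h4 : y - (i : ℚ_[p]) * rep p (n + 1) + -(y - (j : ℚ_[p]) * rep p (n + 1)) =
        (((j : ℤ) - (i : ℤ) : ℤ) : ℚ_[p]) * rep p (n + 1) := by push_cast; ring
    rw [h4, norm_mul, hc] at h3
    have h5 : ‖(((j : ℤ) - (i : ℤ) : ℤ) : ℚ_[p])‖ < 1 := by
      by_contra h; push Not at h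
      have := mul_le_mul_of_nonneg_right h (zpow_pos (prime_pos (p := p)) (n + 1)).le
      linarith
    rw [Padic.norm_intCast_lt_one_iff] at h5
    have hi' := Finset.mem_range.1 hi
    have hj' := Finset.mem_range.1 hj
    apply hij
    -- Two digits in `{0, …, p - 1}` congruent modulo `p` coincide.
    have := Int.eq_zero_of_abs_lt_dvd h5 (by rw [abs_lt]; omega)
    omega
  · intro i _
    exact (measurableSet_pBall n).preimage (by fun_prop)

theorem haar_real_pBall (n : ℤ) : (haar p).real (pBall p n) = (p : ℝ) ^ n := by
  have hs : ∀ n, (haar p).real (pBall p (n + 1)) = p * (haar p).real (pBall p n) := by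
    intro n; simp [Measure.real, haar_pBall_succ]
  have h0 : (haar p).real (pBall p 0) = 1 := by
    have : pBall p 0 = (unitBall p : Set ℚ_[p]) := by
      ext y
      change ‖y‖ ≤ (p : ℝ) ^ (0 : ℤ) ↔ y ∈ Metric.closedBall (0 : ℚ_[p]) 1
      simp
    rw [this, Measure.real, haar, Measure.addHaarMeasure_self]; simp
  induction n with
  | zero => simpa using h0
  | succ n ih => rw [hs, ih, zpow_add_one₀ prime_pos.ne', mul_comm]
  | pred n ih =>
    have := hs (-(n : ℤ) - 1)
    rw [sub_add_cancel, ih] at this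
    rw [zpow_sub_one₀ prime_pos.ne', this]
    field_simp [(prime_pos (p := p)).ne']

theorem haar_real_pSphere (n : ℤ) :
    (haar p).real (pSphere p n) = (1 - (p : ℝ)⁻¹) * (p : ℝ) ^ n := by
  have h := measureReal_union (μ := haar p) (disjoint_pBall_pSphere (n - 1))
    (measurableSet_pSphere _) (haar_pBall_lt_top _).ne (haar_pSphere_lt_top _).ne
  rw [← pBall_succ, sub_add_cancel, haar_real_pBall, haar_real_pBall,
    zpow_sub_one₀ prime_pos.ne'] at h
  linarith

/-- The Haar measure of the unit sphere. -/
def qc (p : ℕ) : ℝ := 1 - (p : ℝ)⁻¹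

theorem qc_pos : 0 < qc p := by
  have := inv_lt_one_of_one_lt₀ (one_lt_prime (p := p)); unfold qc; linarith

/-! ### Radial functions and radial integrals. -/

theorem norm_sub_eq_of_lt {s t : ℚ_[p]} (h : ‖s‖ < ‖t‖) : ‖t - s‖ = ‖t‖ := by
  rw [sub_eq_add_neg, Padic.add_eq_max_of_ne (by rw [norm_neg]; exact h.ne'), norm_neg,
    max_eq_left h.le]

/-- A radial function is locally constant away from `0`, since a perturbation smaller than `|t|`
preserves the absolute value. Its behaviour at the single point `0` does not affect measurability.
-/
theorem IsRadial.measurable {u : ℚ_[p] → ℝ} (hu : IsRadial u) : Measurable u := by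
  apply measurable_of_continuousOn_compl_singleton (0 : ℚ_[p])
  intro t ht
  apply ContinuousAt.continuousWithinAt
  have h : ∀ᶠ s in 𝓝 t, u t = u s := by
    have : ∀ᶠ s in 𝓝 t, ‖t - s‖ < ‖t‖ := by
      have : Tendsto (fun s => ‖t - s‖) (𝓝 t) (𝓝 ‖t - t‖) := by
        apply Continuous.tendsto; fun_prop
      rw [sub_self, norm_zero] at this
      exact this.eventually_lt_const (norm_pos_iff.2 ht)
    filter_upwards [this] with s hs
    apply hu
    have := norm_sub_eq_of_lt hs
    rw [← this]; congr 1; ring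
  exact (continuousAt_const (y := u t)).congr h

/-- Nonnegativity of the values lets the one series serve both for absolute convergence and for the
value of the integral. -/
theorem hasSum_integral_of_eq_on_spheres {g : ℚ_[p] → ℝ} {m : ℕ → ℤ}
    (hm : Function.Injective m) {c : ℕ → ℝ} (hg : ∀ j, ∀ y ∈ pSphere p (m j), g y = c j)
    (hc : ∀ j, 0 ≤ c j) {I : ℝ} (hI : HasSum (fun j => qc p * (p : ℝ) ^ m j * c j) I) :
    IntegrableOn g (⋃ j, pSphere p (m j)) (haar p) ∧
      ∫ y in ⋃ j, pSphere p (m j), g y ∂(haar p) = I := by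
  have h1 : ∀ j, IntegrableOn g (pSphere p (m j)) (haar p) := fun j =>
    (integrableOn_congr_fun (hg j) (measurableSet_pSphere _)).2
      (integrableOn_const (haar_pSphere_lt_top _).ne)
  have h2 : ∀ j, ∫ y in pSphere p (m j), g y ∂(haar p) = qc p * (p : ℝ) ^ m j * c j := by
    intro j
    rw [setIntegral_congr_fun (measurableSet_pSphere _) (hg j), setIntegral_const,
      haar_real_pSphere, smul_eq_mul, qc]
  have h3 : ∀ j, ∫ y in pSphere p (m j), ‖g y‖ ∂(haar p) = qc p * (p : ℝ) ^ m j * c j := by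
    intro j
    rw [← h2 j]
    refine setIntegral_congr_fun (measurableSet_pSphere _) fun y hy => ?_
    simp only [hg j y hy, Real.norm_of_nonneg (hc j)]
  have h4 : IntegrableOn g (⋃ j, pSphere p (m j)) (haar p) :=
    integrableOn_iUnion_of_summable_integral_norm h1 (by simpa only [h3] using hI.summable)
  refine ⟨h4, ?_⟩
  have hd : Pairwise (Function.onFun Disjoint fun j => pSphere p (m j)) := by
    intro i j hij
    simp only [Function.onFun]
    rw [Set.disjoint_left]
    intro y hy hy'
    exact hij (hm (zpow_inj_prime (hy.symm.trans hy')))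
  have h5 := hasSum_integral_iUnion (fun j => measurableSet_pSphere (m j)) hd h4
  simp only [h2] at h5
  exact h5.unique hI

theorem zpow_rpow_add (m n : ℤ) (a : ℝ) :
    ((p : ℝ) ^ (m + n)) ^ a = ((p : ℝ) ^ m) ^ a * ((p : ℝ) ^ n) ^ a := by
  rw [zpow_add₀ prime_pos.ne', Real.mul_rpow (zpow_pos prime_pos _).le (zpow_pos prime_pos _).le]

theorem zpow_succ_rpow (n : ℤ) (a : ℝ) :
    ((p : ℝ) ^ (n + 1)) ^ a = (p : ℝ) ^ a * ((p : ℝ) ^ n) ^ a := by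
  rw [zpow_rpow_add, zpow_one, mul_comm]

theorem zpow_natCast_rpow (j : ℕ) (a : ℝ) : ((p : ℝ) ^ (j : ℤ)) ^ a = ((p : ℝ) ^ a) ^ j := by
  rw [zpow_natCast, ← Real.rpow_natCast, ← Real.rpow_natCast, ← Real.rpow_mul prime_pos.le,
    ← Real.rpow_mul prime_pos.le, mul_comm]

theorem zpow_neg_natCast_rpow (j : ℕ) (a : ℝ) :
    ((p : ℝ) ^ (-(j : ℤ))) ^ a = ((p : ℝ) ^ (-a)) ^ j := by
  rw [zpow_neg, Real.inv_rpow (zpow_pos prime_pos _).le, ← Real.rpow_neg (zpow_pos prime_pos _).le,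
    zpow_natCast_rpow]

theorem rpow_neg_lt_one {a : ℝ} (ha : 0 < a) : (p : ℝ) ^ (-a) < 1 :=
  Real.rpow_lt_one_of_one_lt_of_neg one_lt_prime (by linarith)

theorem mul_rpow_neg {r s : ℝ} (hr : 0 < r) : r * r ^ (-s) = r ^ (1 - s) := by
  rw [sub_eq_add_neg, Real.rpow_add hr, Real.rpow_one]

/-- Up to the null set `{0}` the ball is a union of spheres, and summing over them gives a geometric
series of ratio `p^{-(1-s)}`. -/
theorem integral_rpow_pBall {s : ℝ} (hs : s < 1) (n : ℤ) :
    IntegrableOn (fun y : ℚ_[p] => ‖y‖ ^ (-s)) (pBall p n) (haar p) ∧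
      ∫ y in pBall p n, ‖y‖ ^ (-s) ∂(haar p) =
        qc p / (1 - (p : ℝ) ^ (-(1 - s))) * ((p : ℝ) ^ n) ^ (1 - s) := by
  have hset : (pBall p n : Set ℚ_[p]) =ᵐ[haar p] ⋃ j : ℕ, pSphere p (n + -(j : ℤ)) := by
    have h0 : haar p {(0 : ℚ_[p])} = 0 := measure_singleton 0
    have : pBall p n \ {0} = ⋃ j : ℕ, pSphere p (n + -(j : ℤ)) := by
      ext y
      simp only [Set.mem_sdiff, Set.mem_singleton_iff, Set.mem_iUnion, mem_pBall, mem_pSphere]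
      constructor
      · rintro ⟨h, hy⟩
        obtain ⟨m, hm⟩ := exists_norm_eq_zpow hy
        rw [hm, zpow_le_zpow_iff_prime] at h
        exact ⟨(n - m).toNat, by rw [hm]; congr 1; omega⟩
      · rintro ⟨j, hj⟩
        refine ⟨by rw [hj, zpow_le_zpow_iff_prime]; omega, ?_⟩
        apply norm_pos_iff.1; rw [hj]; exact zpow_pos prime_pos _
    rw [← this]
    exact (sdiff_null_ae_eq_self h0).symm
  have key := hasSum_integral_of_eq_on_spheres (p := p) (g := fun y => ‖y‖ ^ (-s))
    (m := fun j => n + -(j : ℤ)) (fun i j h => by simpa using h)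
    (c := fun j => ((p : ℝ) ^ (n + -(j : ℤ))) ^ (-s))
    (fun j y hy => by rw [mem_pSphere.1 hy])
    (fun j => Real.rpow_nonneg (zpow_pos prime_pos _).le _)
    (I := qc p / (1 - (p : ℝ) ^ (-(1 - s))) * ((p : ℝ) ^ n) ^ (1 - s)) (by
      have := (hasSum_geometric_of_lt_one (Real.rpow_nonneg prime_pos.le _)
        (rpow_neg_lt_one (p := p) (sub_pos.2 hs))).mul_left (qc p * ((p : ℝ) ^ n) ^ (1 - s))
      convert this using 1
      · rfl
      · funext j
        rw [mul_assoc, mul_rpow_neg (zpow_pos prime_pos _), zpow_rpow_add, zpow_neg_natCast_rpow,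
          mul_assoc]
      · rw [div_eq_mul_inv]; ring)
  exact ⟨key.1.congr_set_ae hset, (setIntegral_congr_set hset).trans key.2⟩

theorem integral_rpow_compl_pBall {s : ℝ} (hs : 1 < s) (n : ℤ) :
    IntegrableOn (fun y : ℚ_[p] => ‖y‖ ^ (-s)) (pBall p n)ᶜ (haar p) ∧
      ∫ y in (pBall p n)ᶜ, ‖y‖ ^ (-s) ∂(haar p) =
        qc p / (1 - (p : ℝ) ^ (-(s - 1))) * ((p : ℝ) ^ (n + 1)) ^ (1 - s) := by
  have hset : (pBall p n)ᶜ = ⋃ j : ℕ, pSphere p (n + 1 + (j : ℤ)) := by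
    ext y
    simp only [Set.mem_compl_iff, Set.mem_iUnion, mem_pBall, mem_pSphere]
    constructor
    · intro h
      have hy : y ≠ 0 := by
        rintro rfl; rw [norm_zero] at h; exact h (zpow_pos prime_pos _).le
      obtain ⟨m, hm⟩ := exists_norm_eq_zpow hy
      rw [hm, zpow_le_zpow_iff_prime] at h
      exact ⟨(m - (n + 1)).toNat, by rw [hm]; congr 1; omega⟩
    · rintro ⟨j, hj⟩
      rw [hj, zpow_le_zpow_iff_prime]; omega
  have key := hasSum_integral_of_eq_on_spheres (p := p) (g := fun y => ‖y‖ ^ (-s))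
    (m := fun j => n + 1 + (j : ℤ)) (fun i j h => by simpa using h)
    (c := fun j => ((p : ℝ) ^ (n + 1 + (j : ℤ))) ^ (-s))
    (fun j y hy => by rw [mem_pSphere.1 hy])
    (fun j => Real.rpow_nonneg (zpow_pos prime_pos _).le _)
    (I := qc p / (1 - (p : ℝ) ^ (-(s - 1))) * ((p : ℝ) ^ (n + 1)) ^ (1 - s)) (by
      have := (hasSum_geometric_of_lt_one (Real.rpow_nonneg prime_pos.le _)
        (rpow_neg_lt_one (p := p) (sub_pos.2 hs))).mul_left (qc p * ((p : ℝ) ^ (n + 1)) ^ (1 - s))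
      convert this using 1
      · rfl
      · funext j
        rw [mul_assoc, mul_rpow_neg (zpow_pos prime_pos _), zpow_rpow_add, zpow_natCast_rpow,
          mul_assoc, neg_sub]
      · rw [div_eq_mul_inv]; ring)
  rw [hset]
  exact key

end

/-! ### The fractional integral of radial functions. -/

noncomputable section

variable {p : ℕ} [hp : Fact p.Prime]

/-- Invariance makes `d` constant, and the bound tends to `0` as `n → -∞` when `e > 0` and as `n →
+∞` when `e < 0`. -/
theorem eq_zero_of_invariant_of_abs_le {d : ℤ → ℝ} (h : ∀ n, d (n + 1) = d n) {C e : ℝ}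
    (he : e ≠ 0) (hb : ∀ n, |d n| ≤ C * ((p : ℝ) ^ n) ^ e) (n : ℤ) : d n = 0 := by
  have hc : ∀ n, d n = d 0 := by
    intro n
    induction n with
    | zero => rfl
    | succ n ih => rw [h, ih]
    | pred n ih => rw [← ih, ← h (-(n : ℤ) - 1), sub_add_cancel]
  have hC : ∀ r : ℝ, 0 ≤ r → r < 1 → (∀ j : ℕ, |d 0| ≤ C * r ^ j) → d 0 = 0 := by
    intro r h0 h1 hr
    have := ge_of_tendsto' ((tendsto_pow_atTop_nhds_zero_of_lt_one h0 h1).const_mul C) hr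
    rw [mul_zero] at this
    exact abs_nonpos_iff.1 this
  rw [hc]
  rcases lt_or_gt_of_ne he with he | he
  · refine hC ((p : ℝ) ^ e) (Real.rpow_nonneg prime_pos.le _)
      (Real.rpow_lt_one_of_one_lt_of_neg one_lt_prime he) fun j => ?_
    rw [← zpow_natCast_rpow, ← hc j]; exact hb j
  · refine hC ((p : ℝ) ^ (-e)) (Real.rpow_nonneg prime_pos.le _) (rpow_neg_lt_one he) fun j => ?_
    rw [← zpow_neg_natCast_rpow, ← hc (-j)]; exact hb _

/-- This is where the precise value of `c_α` matters: after normalization the kernel increment has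
one formula, so the logarithmic case needs no separate treatment in the recursions. -/
theorem fracConst_mul_fracKernel_sub (α : ℝ) (n : ℤ) :
    fracConst p α * (fracKernel α ((p : ℝ) ^ (n + 1)) - fracKernel α ((p : ℝ) ^ n)) =
      -(1 - (p : ℝ) ^ (-α)) * ((p : ℝ) ^ n) ^ (α - 1) := by
  have hp0 := prime_pos (p := p)
  have hp1 := one_lt_prime (p := p)
  unfold fracConst fracKernel
  split_ifs with h
  · subst h
    have hl := Real.log_pos hp1
    rw [Real.log_zpow, Real.log_zpow, sub_self, Real.rpow_zero, Real.rpow_neg_one]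
    push_cast
    field_simp
    ring
  · rw [zpow_succ_rpow]
    have : 1 - (p : ℝ) ^ (α - 1) ≠ 0 := by
      intro h'
      have h2 : (p : ℝ) ^ (α - 1) = (p : ℝ) ^ (0 : ℝ) := by rw [Real.rpow_zero]; linarith
      rw [Real.rpow_right_inj hp0 hp1.ne'] at h2
      exact h (by linarith)
    field_simp
    ring

/-- By homogeneity everything reduces to `ρ = r/R ≤ 1`, where both `|log ρ|` and `1 + ρ^{α-1}` are
dominated by a multiple of `ρ^{-s}`. -/
theorem exists_abs_fracKernel_sub_le {α s : ℝ} (hs : 0 < s) (hαs : 1 - α ≤ s) :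
    ∃ C : ℝ, 0 ≤ C ∧ ∀ r R : ℝ, 0 < r → r ≤ R →
      |fracKernel α R - fracKernel α r| ≤ C * R ^ (α - 1 + s) * r ^ (-s) := by
  have hsplit : ∀ r R : ℝ, 0 < r → r ≤ R →
      R ^ (α - 1 + s) * r ^ (-s) = R ^ (α - 1) * (r / R) ^ (-s) := by
    intro r R hr hR
    rw [Real.div_rpow hr.le (hr.trans_le hR).le, Real.rpow_add (hr.trans_le hR),
      Real.rpow_neg (hr.trans_le hR).le, div_eq_mul_inv, inv_inv]
    ring
  by_cases h : α = 1
  · refine ⟨1 / s, by positivity, fun r R hr hR => ?_⟩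
    have hR0 := hr.trans_le hR
    rw [mul_assoc, hsplit r R hr hR]
    simp only [fracKernel, h, if_true, sub_self, Real.rpow_zero, one_mul]
    have hρ : 0 < r / R := div_pos hr hR0
    have := Real.abs_log_mul_self_rpow_lt (r / R) s hρ ((div_le_one hR0).2 hR) hs
    rw [abs_mul, abs_of_pos (Real.rpow_pos_of_pos hρ s)] at this
    rw [abs_sub_comm, ← Real.log_div hr.ne' hR0.ne', Real.rpow_neg hρ.le, ← div_eq_mul_inv]
    exact (lt_div_iff₀ (Real.rpow_pos_of_pos hρ s)).2 this |>.le
  · refine ⟨2, by norm_num, fun r R hr hR => ?_⟩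
    have hR0 := hr.trans_le hR
    rw [mul_assoc, hsplit r R hr hR]
    simp only [fracKernel, h, if_false]
    have hρ : 0 < r / R := div_pos hr hR0
    have hρ1 : r / R ≤ 1 := (div_le_one hR0).2 hR
    have h1 : (1 : ℝ) ≤ (r / R) ^ (-s) :=
      Real.one_le_rpow_of_pos_of_le_one_of_nonpos hρ hρ1 (by linarith)
    have h2 : (r / R) ^ (α - 1) ≤ (r / R) ^ (-s) :=
      Real.rpow_le_rpow_of_exponent_ge hρ hρ1 (by linarith)
    have h3 : r ^ (α - 1) = R ^ (α - 1) * (r / R) ^ (α - 1) := by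
      rw [← Real.mul_rpow hR0.le hρ.le, mul_div_cancel₀ _ hR0.ne']
    have h4 : 0 < R ^ (α - 1) := Real.rpow_pos_of_pos hR0 _
    have h5 : 0 < (r / R) ^ (α - 1) := Real.rpow_pos_of_pos hρ _
    rw [h3]
    rw [show R ^ (α - 1) - R ^ (α - 1) * (r / R) ^ (α - 1) =
      R ^ (α - 1) * (1 - (r / R) ^ (α - 1)) by ring, abs_mul, abs_of_pos h4]
    have h6 : |1 - (r / R) ^ (α - 1)| ≤ 2 * (r / R) ^ (-s) := by
      rw [abs_le]; constructor <;> linarith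
    calc _ ≤ R ^ (α - 1) * (2 * (r / R) ^ (-s)) := by gcongr
      _ = _ := by ring

theorem measurable_fracKernel (α : ℝ) : Measurable (fracKernel α) := by
  unfold fracKernel
  by_cases h : α = 1
  · simpa only [h, if_true] using Real.measurable_log
  · simp only [h, if_false]; fun_prop

theorem ae_ne_zero (s : Set ℚ_[p]) : ∀ᵐ y ∂(haar p).restrict s, y ≠ 0 :=
  ae_restrict_of_ae (compl_mem_ae_iff.2 (measure_singleton 0))

/-- Pointwise domination `|ψ(y)| ≤ M |y|^{-γ}`. -/
def PowerBound (M γ : ℝ) (ψ : ℚ_[p] → ℝ) : Prop := ∀ y, |ψ y| ≤ M * ‖y‖ ^ (-γ)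

theorem PowerBound.nonneg {M γ : ℝ} {ψ : ℚ_[p] → ℝ} (h : PowerBound M γ ψ) : 0 ≤ M := by
  have := (abs_nonneg _).trans (h 1)
  simpa using this

/-- The constant is uniform in the radius, in `M` and in the source. This uniformity drives both the
vanishing argument and the contraction. -/
theorem exists_kernel_integral_bound {α γ : ℝ} (hγ1 : γ < 1) (hγα : γ < α) :
    ∃ C : ℝ, 0 ≤ C ∧ ∀ (n : ℤ) (M : ℝ) (ψ : ℚ_[p] → ℝ), Measurable ψ → PowerBound M γ ψ →
      IntegrableOn (fun y => (fracKernel α ((p : ℝ) ^ n) - fracKernel α ‖y‖) * ψ y)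
        (pBall p n) (haar p) ∧
      |∫ y in pBall p n, (fracKernel α ((p : ℝ) ^ n) - fracKernel α ‖y‖) * ψ y ∂(haar p)| ≤
        C * M * ((p : ℝ) ^ n) ^ (α - γ) := by
  obtain ⟨s, hs0, hs1, hs2⟩ : ∃ s, 0 < s ∧ 1 - α ≤ s ∧ s + γ < 1 := by
    -- The midpoint of the interval from `max(0, 1-α)` to `1-γ`, which is nonempty because `γ < 1`
    -- and `γ < α`.
    refine ⟨(max 0 (1 - α) + (1 - γ)) / 2, ?_, ?_, ?_⟩
    · have := le_max_left 0 (1 - α); linarith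
    · have := le_max_right 0 (1 - α); linarith
    · have : max 0 (1 - α) < 1 - γ := max_lt (by linarith) (by linarith)
      linarith
  obtain ⟨K, hK0, hK⟩ := exists_abs_fracKernel_sub_le hs0 hs1
  have hD : 0 < 1 - (p : ℝ) ^ (-(1 - (s + γ))) := sub_pos.2 (rpow_neg_lt_one (by linarith))
  refine ⟨K * (qc p / (1 - (p : ℝ) ^ (-(1 - (s + γ))))), mul_nonneg hK0 (div_pos qc_pos hD).le,
    fun n M ψ hψm hψ => ?_⟩
  have hpn := zpow_pos (prime_pos (p := p)) n
  obtain ⟨hi, hI⟩ := integral_rpow_pBall (p := p) hs2 n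
  have hi' := hi.const_mul (K * ((p : ℝ) ^ n) ^ (α - 1 + s) * M)
  have hae : ∀ᵐ y ∂(haar p).restrict (pBall p n),
      ‖(fracKernel α ((p : ℝ) ^ n) - fracKernel α ‖y‖) * ψ y‖ ≤
        K * ((p : ℝ) ^ n) ^ (α - 1 + s) * M * ‖y‖ ^ (-(s + γ)) := by
    filter_upwards [ae_ne_zero (pBall p n), ae_restrict_mem (measurableSet_pBall n)] with y hy hy'
    have hy0 := norm_pos_iff.2 hy
    rw [norm_mul, Real.norm_eq_abs, Real.norm_eq_abs]
    calc _ ≤ (K * ((p : ℝ) ^ n) ^ (α - 1 + s) * ‖y‖ ^ (-s)) * (M * ‖y‖ ^ (-γ)) :=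
          mul_le_mul (hK _ _ hy0 hy') (hψ y) (abs_nonneg _) (by positivity)
      _ = _ := by rw [neg_add, Real.rpow_add hy0]; ring
  refine ⟨hi'.mono' ?_ hae, ?_⟩
  · exact (((measurable_const.sub ((measurable_fracKernel α).comp measurable_norm)).mul
      hψm)).aestronglyMeasurable
  · refine (norm_integral_le_of_norm_le hi' hae).trans_eq ?_
    rw [integral_const_mul, hI, show α - γ = (α - 1 + s) + (1 - (s + γ)) by ring,
      Real.rpow_add hpn (α - 1 + s)]
    ring

/-- For `t` in the ball, `y ↦ t - y` is a measure-preserving involution of the ball. -/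
theorem integrableOn_pBall_sub {h : ℚ_[p] → ℝ} {n : ℤ} {t : ℚ_[p]} (ht : t ∈ pBall p n)
    (hh : IntegrableOn h (pBall p n) (haar p)) :
    IntegrableOn (fun y => h (t - y)) (pBall p n) (haar p) ∧
      ∫ y in pBall p n, h (t - y) ∂(haar p) = ∫ y in pBall p n, h y ∂(haar p) := by
  have hind : (fun y => (pBall p n).indicator h (t - y)) =
      (pBall p n).indicator fun y => h (t - y) := by
    funext y
    have hiff : t - y ∈ pBall p n ↔ y ∈ pBall p n := by
      have key : ∀ z, z ∈ pBall p n → t - z ∈ pBall p n := fun z hz => by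
        have := Padic.nonarchimedean t (-z)
        rw [norm_neg, ← sub_eq_add_neg] at this
        exact this.trans (max_le ht hz)
      exact ⟨fun h => by simpa using key _ h, key y⟩
    by_cases hy : y ∈ pBall p n
    · rw [Set.indicator_of_mem (hiff.2 hy), Set.indicator_of_mem hy]
    · rw [Set.indicator_of_notMem (hiff.not.2 hy), Set.indicator_of_notMem hy]
  have hm := measurableSet_pBall (p := p) n
  rw [← integrable_indicator_iff hm, ← hind, ← integral_indicator hm, ← hind,
    ← integral_indicator hm]
  exact ⟨(hh.integrable_indicator hm).comp_sub_left t, integral_sub_left_eq_self _ _ t⟩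

theorem setIntegral_pBall_succ {g : ℚ_[p] → ℝ} {n : ℤ}
    (hg : IntegrableOn g (pBall p (n + 1)) (haar p)) :
    ∫ y in pBall p (n + 1), g y ∂(haar p) =
      ∫ y in pBall p n, g y ∂(haar p) + ∫ y in pSphere p (n + 1), g y ∂(haar p) := by
  rw [pBall_succ] at hg ⊢
  exact setIntegral_union (disjoint_pBall_pSphere n) (measurableSet_pSphere _)
    (hg.mono_set Set.subset_union_left) (hg.mono_set Set.subset_union_right)

theorem setIntegral_pSphere_of_eq {g : ℚ_[p] → ℝ} {n : ℤ} {c : ℝ}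
    (h : ∀ y ∈ pSphere p n, g y = c) :
    ∫ y in pSphere p n, g y ∂(haar p) = qc p * (p : ℝ) ^ n * c := by
  rw [setIntegral_congr_fun (measurableSet_pSphere _) h, setIntegral_const,
    haar_real_pSphere, smul_eq_mul, qc]

theorem setIntegral_pBall_of_eq_zero {g : ℚ_[p] → ℝ} {n : ℤ}
    (hg : IntegrableOn g (pBall p (n + 1)) (haar p)) (h : ∀ y ∈ pSphere p (n + 1), g y = 0) :
    ∫ y in pBall p (n + 1), g y ∂(haar p) = ∫ y in pBall p n, g y ∂(haar p) := by
  rw [setIntegral_pBall_succ hg, setIntegral_pSphere_of_eq h, mul_zero, add_zero]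

theorem pBall_subset_succ (n : ℤ) : pBall p n ⊆ pBall p (n + 1) := by
  rw [pBall_succ]; exact Set.subset_union_left

/-- Comparison of the kernel integrals over consecutive balls. -/
theorem kernel_integral_succ {α γ M : ℝ} (hγ1 : γ < 1) (hγα : γ < α) {ψ : ℚ_[p] → ℝ}
    (hψm : Measurable ψ) (hψ : PowerBound M γ ψ) (n : ℤ) :
    IntegrableOn ψ (pBall p n) (haar p) ∧
    ∫ y in pBall p (n + 1), (fracKernel α ((p : ℝ) ^ (n + 1)) - fracKernel α ‖y‖) * ψ y ∂(haar p) =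
      ∫ y in pBall p n, (fracKernel α ((p : ℝ) ^ (n + 1)) - fracKernel α ‖y‖) * ψ y ∂(haar p) ∧
    ∫ y in pBall p n, (fracKernel α ((p : ℝ) ^ (n + 1)) - fracKernel α ‖y‖) * ψ y ∂(haar p) =
      (fracKernel α ((p : ℝ) ^ (n + 1)) - fracKernel α ((p : ℝ) ^ n)) *
          ∫ y in pBall p n, ψ y ∂(haar p) +
        ∫ y in pBall p n, (fracKernel α ((p : ℝ) ^ n) - fracKernel α ‖y‖) * ψ y ∂(haar p) := by
  obtain ⟨C, -, hC⟩ := exists_kernel_integral_bound (p := p) hγ1 hγα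
  have h0 : IntegrableOn ψ (pBall p n) (haar p) :=
    ((integral_rpow_pBall hγ1 n).1.const_mul M).mono' hψm.aestronglyMeasurable
      (ae_of_all _ hψ)
  refine ⟨h0, setIntegral_pBall_of_eq_zero (hC _ M ψ hψm hψ).1 ?_, ?_⟩
  · intro y hy; rw [mem_pSphere.1 hy, sub_self, zero_mul]
  · rw [← integral_const_mul, ← integral_add (h0.const_mul _) (hC _ M ψ hψm hψ).1]
    congr 1; funext y; ring

/-- The sum of the two sides' difference is unchanged under `n ↦ n + 1` and is `O(p^{nα})`, so it
vanishes because `α > 0`. -/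
theorem fracConst_mul_integral_kernel {α : ℝ} (hα : 0 < α) (n : ℤ) :
    fracConst p α * ∫ y in pBall p (n + 1),
      (fracKernel α ((p : ℝ) ^ (n + 1)) - fracKernel α ‖y‖) ∂(haar p) = -((p : ℝ) ^ n) ^ α := by
  have hψ : PowerBound (p := p) 1 0 (fun _ => 1) := fun y => by simp
  obtain ⟨C, -, hC⟩ := exists_kernel_integral_bound (p := p) (α := α) one_pos hα
  have hb : ∀ n, |fracConst p α * ∫ y in pBall p (n + 1),
      (fracKernel α ((p : ℝ) ^ (n + 1)) - fracKernel α ‖y‖) ∂(haar p)| ≤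
        |fracConst p α| * C * (p : ℝ) ^ α * ((p : ℝ) ^ n) ^ α := by
    intro n
    have := (hC (n + 1) 1 _ measurable_const hψ).2
    simp only [mul_one, sub_zero, zpow_succ_rpow n α] at this
    rw [abs_mul, mul_assoc, mul_assoc]
    exact mul_le_mul_of_nonneg_left this (abs_nonneg _)
  have := eq_zero_of_invariant_of_abs_le (p := p) (e := α)
    (d := fun n => fracConst p α * ∫ y in pBall p (n + 1),
      (fracKernel α ((p : ℝ) ^ (n + 1)) - fracKernel α ‖y‖) ∂(haar p) + ((p : ℝ) ^ n) ^ α)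
    (C := |fracConst p α| * C * (p : ℝ) ^ α + 1) ?_ hα.ne' ?_ n
  · linarith
  · intro n
    obtain ⟨-, h1, h2⟩ := kernel_integral_succ (α := α) one_pos hα measurable_const hψ (n + 1)
    simp only [mul_one, setIntegral_const, haar_real_pBall, smul_eq_mul] at h1 h2
    rw [h1, h2, mul_add, ← mul_assoc, fracConst_mul_fracKernel_sub, zpow_succ_rpow n α,
      Real.rpow_sub_one (zpow_pos prime_pos _).ne', zpow_succ_rpow n α, Real.rpow_neg prime_pos.le]
    have h3 := (zpow_pos (prime_pos (p := p)) (n + 1)).ne'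
    have h4 := (Real.rpow_pos_of_pos (prime_pos (p := p)) α).ne'
    field_simp
    ring
  · intro n
    have h1 : 0 ≤ ((p : ℝ) ^ n) ^ α := Real.rpow_nonneg (zpow_pos prime_pos _).le _
    calc _ ≤ _ := abs_add_le _ _
      _ ≤ _ := add_le_add (hb n) (abs_of_nonneg h1).le
      _ = _ := by ring

/-- The radial form of `I^α`. -/
theorem fracIntegral_eq {α γ M : ℝ} (hγ0 : 0 ≤ γ) (hγ1 : γ < 1) (hγα : γ < α) {φ : ℚ_[p] → ℝ}
    (hφr : IsRadial φ) (hφ : PowerBound M γ φ) {n : ℤ} {t : ℚ_[p]} (ht : ‖t‖ = (p : ℝ) ^ (n + 1)) :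
    FracIntegralExistsAt α φ t ∧
    fracIntegral α φ t = fracConst p α * ∫ y in pBall p n,
        (fracKernel α ((p : ℝ) ^ (n + 1)) - fracKernel α ‖y‖) * φ y ∂(haar p) +
      ((p : ℝ) ^ n) ^ α * φ t := by
  have hα : 0 < α := hγ0.trans_lt hγα
  obtain ⟨C, -, hC⟩ := exists_kernel_integral_bound (p := p) hγ1 hγα
  obtain ⟨C', -, hC'⟩ := exists_kernel_integral_bound (p := p) (α := α) one_pos hα
  have hset : {y : ℚ_[p] | ‖y‖ ≤ ‖t‖} = pBall p (n + 1) := by rw [ht]; rfl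
  have htb : t ∈ pBall p (n + 1) := ht.le
  have hψ : PowerBound (p := p) 1 0 (fun _ => 1) := fun y => by simp
  have hK : IntegrableOn (fun y => fracKernel α ((p : ℝ) ^ (n + 1)) - fracKernel α ‖y‖)
      (pBall p (n + 1)) (haar p) := by
    simpa using (hC' (n + 1) 1 _ measurable_const hψ).1
  obtain ⟨hKt, hKI⟩ := integrableOn_pBall_sub htb hK
  have hlt : ∀ y ∈ pBall p n, ‖t - y‖ = (p : ℝ) ^ (n + 1) := fun y hy => by
    rw [norm_sub_eq_of_lt, ht]; rw [ht]; exact norm_lt_zpow_succ.2 hy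
  have hI1 := (hC (n + 1) M φ hφr.measurable hφ).1
  have hball : Set.EqOn (fracIntegrand α φ t)
      (fun y => (fracKernel α ((p : ℝ) ^ (n + 1)) - fracKernel α ‖y‖) * φ y) (pBall p n) :=
    fun y hy => by simp only [fracIntegrand, hlt y hy]
  have hsph : Set.EqOn (fracIntegrand α φ t)
      (fun y => -φ t * (fracKernel α ((p : ℝ) ^ (n + 1)) - fracKernel α ‖t - y‖))
      (pSphere p (n + 1)) := fun y hy => by
    simp only [fracIntegrand, mem_pSphere.1 hy, hφr y t ((mem_pSphere.1 hy).trans ht.symm)]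
    ring
  have hex : IntegrableOn (fracIntegrand α φ t) (pBall p (n + 1)) (haar p) := by
    rw [pBall_succ]
    exact ((integrableOn_congr_fun hball (measurableSet_pBall _)).2
      (hI1.mono_set (pBall_subset_succ n))).union
      ((integrableOn_congr_fun hsph (measurableSet_pSphere _)).2
        ((hKt.mono_set (pSphere_subset_pBall _)).const_mul _))
  refine ⟨by rw [FracIntegralExistsAt, hset]; exact hex, ?_⟩
  -- The integrand vanishes on the inner ball, where `|t - y| = p^{n+1}`. The sphere can thus be
  -- enlarged to the whole ball, and then `t - y` replaced by `y`.
  have hS : ∫ y in pSphere p (n + 1), (fracKernel α ((p : ℝ) ^ (n + 1)) - fracKernel α ‖t - y‖)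
      ∂(haar p) =
      ∫ y in pBall p (n + 1), (fracKernel α ((p : ℝ) ^ (n + 1)) - fracKernel α ‖y‖) ∂(haar p) := by
    rw [← hKI, setIntegral_pBall_succ hKt]
    have : ∫ y in pBall p n, (fracKernel α ((p : ℝ) ^ (n + 1)) - fracKernel α ‖t - y‖)
        ∂(haar p) = 0 :=
      setIntegral_eq_zero_of_forall_eq_zero fun y hy => by rw [hlt y hy, sub_self]
    rw [this, zero_add]
  rw [fracIntegral, hset, setIntegral_pBall_succ hex,
    setIntegral_congr_fun (measurableSet_pBall _) hball,
    setIntegral_congr_fun (measurableSet_pSphere _) hsph, integral_const_mul, hS, mul_add]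
  have := fracConst_mul_integral_kernel (p := p) hα n
  linear_combination (-φ t) * this

theorem fracIntegral_zero (α : ℝ) (φ : ℚ_[p] → ℝ) :
    FracIntegralExistsAt α φ 0 ∧ fracIntegral α φ 0 = 0 := by
  have hset : {y : ℚ_[p] | ‖y‖ ≤ ‖(0 : ℚ_[p])‖} = {0} := by ext y; simp
  have h0 : haar p {(0 : ℚ_[p])} = 0 := measure_singleton 0
  rw [FracIntegralExistsAt, fracIntegral, hset, Measure.restrict_zero_set h0]
  rw [IntegrableOn, Measure.restrict_zero_set h0]
  simp

theorem fracIntegral_existsAt {α γ M : ℝ} (hγ0 : 0 ≤ γ) (hγ1 : γ < 1) (hγα : γ < α)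
    {φ : ℚ_[p] → ℝ} (hφr : IsRadial φ) (hφ : PowerBound M γ φ) (t : ℚ_[p]) :
    FracIntegralExistsAt α φ t := by
  rcases eq_or_ne t 0 with rfl | ht
  · exact (fracIntegral_zero α φ).1
  · obtain ⟨n, hn⟩ := exists_norm_eq_zpow ht
    rw [← sub_add_cancel n 1] at hn
    exact (fracIntegral_eq hγ0 hγ1 hγα hφr hφ hn).1

theorem isRadial_fracIntegral {α γ M : ℝ} (hγ0 : 0 ≤ γ) (hγ1 : γ < 1) (hγα : γ < α)
    {φ : ℚ_[p] → ℝ} (hφr : IsRadial φ) (hφ : PowerBound M γ φ) :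
    IsRadial (fracIntegral α φ) := by
  intro s t hst
  rcases eq_or_ne t 0 with rfl | ht
  · rw [norm_zero, norm_eq_zero] at hst; rw [hst]
  · obtain ⟨n, hn⟩ := exists_norm_eq_zpow ht
    rw [← sub_add_cancel n 1] at hn
    rw [(fracIntegral_eq hγ0 hγ1 hγα hφr hφ hn).2,
      (fracIntegral_eq hγ0 hγ1 hγα hφr hφ (hst.trans hn)).2, hφr s t hst]

/-- The ball term and the sphere term of the radial form scale alike, as `|t|^{α-γ}`. -/
theorem exists_abs_fracIntegral_le {α γ : ℝ} (hγ0 : 0 ≤ γ) (hγ1 : γ < 1) (hγα : γ < α) :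
    ∃ C : ℝ, 0 ≤ C ∧ ∀ (M : ℝ) (φ : ℚ_[p] → ℝ), IsRadial φ → PowerBound M γ φ → ∀ t,
      |fracIntegral α φ t| ≤ C * M * ‖t‖ ^ (α - γ) := by
  obtain ⟨C, hC0, hC⟩ := exists_kernel_integral_bound (p := p) hγ1 hγα
  refine ⟨|fracConst p α| * C + 1, by positivity, fun M φ hφr hφ t => ?_⟩
  have hM := hφ.nonneg
  rcases eq_or_ne t 0 with rfl | ht
  · rw [(fracIntegral_zero α φ).2, abs_zero]; positivity
  · obtain ⟨n, hn⟩ := exists_norm_eq_zpow ht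
    rw [← sub_add_cancel n 1] at hn
    have hpos := zpow_pos (prime_pos (p := p)) (n - 1)
    rw [(fracIntegral_eq hγ0 hγ1 hγα hφr hφ hn).2,
      ← (kernel_integral_succ hγ1 hγα hφr.measurable hφ _).2.1]
    have h1 := (hC (n - 1 + 1) M φ hφr.measurable hφ).2
    have h2 : |((p : ℝ) ^ (n - 1)) ^ α * φ t| ≤ M * ‖t‖ ^ (α - γ) := by
      rw [abs_mul, abs_of_nonneg (Real.rpow_nonneg hpos.le _)]
      calc _ ≤ ‖t‖ ^ α * (M * ‖t‖ ^ (-γ)) := by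
            refine mul_le_mul (Real.rpow_le_rpow hpos.le ?_ (hγ0.trans hγα.le)) (hφ t)
              (abs_nonneg _) (by positivity)
            rw [hn, zpow_le_zpow_iff_prime]; omega
        _ = _ := by rw [sub_eq_add_neg α, Real.rpow_add (norm_pos_iff.2 ht)]; ring
    rw [← hn] at h1
    calc _ ≤ _ := abs_add_le _ _
      _ ≤ |fracConst p α| * (C * M * ‖t‖ ^ (α - γ)) + M * ‖t‖ ^ (α - γ) := by
        rw [abs_mul (fracConst p α), ← hn]; gcongr
      _ = _ := by ring

end

/-! ### Inversion of `I^α` by `D^α` on radial functions. -/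

section

variable {p : ℕ}

/-- `d n = O(p ^ {n e})`, uniformly in `n : ℤ`. -/
def ZPowBound (p : ℕ) (e : ℝ) (d : ℤ → ℝ) : Prop := ∃ C : ℝ, ∀ n, |d n| ≤ C * ((p : ℝ) ^ n) ^ e

theorem ZPowBound.add {e : ℝ} {d d' : ℤ → ℝ} (h : ZPowBound p e d) (h' : ZPowBound p e d') :
    ZPowBound p e fun n => d n + d' n := by
  obtain ⟨C, hC⟩ := h
  obtain ⟨C', hC'⟩ := h'
  refine ⟨C + C', fun n => ?_⟩
  rw [add_mul]
  exact (abs_add_le _ _).trans (add_le_add (hC n) (hC' n))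

theorem ZPowBound.const_mul {e : ℝ} {d : ℤ → ℝ} (h : ZPowBound p e d) (c : ℝ) :
    ZPowBound p e fun n => c * d n := by
  obtain ⟨C, hC⟩ := h
  refine ⟨|c| * C, fun n => ?_⟩
  rw [abs_mul, mul_assoc]
  exact mul_le_mul_of_nonneg_left (hC n) (abs_nonneg _)

theorem ZPowBound.congr {e e' : ℝ} {d d' : ℤ → ℝ} (h : ZPowBound p e d) (he : e = e')
    (hd : ∀ n, d n = d' n) : ZPowBound p e' d' := by
  obtain rfl := funext hd
  exact he ▸ h

variable [hp : Fact p.Prime]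

theorem ZPowBound.mul {e e' : ℝ} {d d' : ℤ → ℝ} (h : ZPowBound p e d) (h' : ZPowBound p e' d') :
    ZPowBound p (e + e') fun n => d n * d' n := by
  obtain ⟨C, hC⟩ := h
  obtain ⟨C', hC'⟩ := h'
  refine ⟨C * C', fun n => ?_⟩
  rw [abs_mul, Real.rpow_add (zpow_pos prime_pos _)]
  calc _ ≤ _ := mul_le_mul (hC n) (hC' n) (abs_nonneg _) ((abs_nonneg _).trans (hC n))
    _ = _ := by ring

theorem zpowBound_rpow (e : ℝ) : ZPowBound p e fun n => ((p : ℝ) ^ n) ^ e :=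
  ⟨1, fun n => by rw [one_mul, abs_of_nonneg (Real.rpow_nonneg (zpow_pos prime_pos _).le _)]⟩

theorem ZPowBound.eq_zero {e : ℝ} {d : ℤ → ℝ} (h : ZPowBound p e d) (he : e ≠ 0)
    (hd : ∀ n, d (n + 1) = d n) (n : ℤ) : d n = 0 := by
  obtain ⟨C, hC⟩ := h
  exact eq_zero_of_invariant_of_abs_le hd he hC n

/-- A radial solution `u = u₀ + I^α φ` with a radial source satisfying `|φ(y)| ≤ M |y|^{-γ}`. -/
structure RadialSolution (p : ℕ) [Fact p.Prime] (α γ M u₀ : ℝ) (φ u : ℚ_[p] → ℝ) : Prop where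
  hγ0 : 0 < γ
  hγ1 : γ < 1
  hγα : γ < α
  radial : IsRadial φ
  bound : PowerBound M γ φ
  eq : ∀ t, u t = u₀ + fracIntegral α φ t

namespace RadialSolution

variable {α γ M u₀ : ℝ} {φ u : ℚ_[p] → ℝ}

theorem pos (h : RadialSolution p α γ M u₀ φ u) : 0 < α := h.hγ0.trans h.hγα

theorem isRadial (h : RadialSolution p α γ M u₀ φ u) : IsRadial u := fun s t hst => by
  rw [h.eq, h.eq, isRadial_fracIntegral h.hγ0.le h.hγ1 h.hγα h.radial h.bound s t hst]

theorem exists_abs_sub_le (h : RadialSolution p α γ M u₀ φ u) :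
    ∃ K, 0 ≤ K ∧ ∀ t, |u t - u₀| ≤ K * ‖t‖ ^ (α - γ) := by
  obtain ⟨C, hC0, hC⟩ := exists_abs_fracIntegral_le (p := p) h.hγ0.le h.hγ1 h.hγα
  refine ⟨C * M, mul_nonneg hC0 h.bound.nonneg, fun t => ?_⟩
  rw [h.eq, add_sub_cancel_left]
  exact hC M φ h.radial h.bound t

theorem abs_sub_rep_le (h : RadialSolution p α γ M u₀ φ u) {K : ℝ} (hK0 : 0 ≤ K)
    (hK : ∀ t, |u t - u₀| ≤ K * ‖t‖ ^ (α - γ)) (n : ℤ) {y : ℚ_[p]} (hy : y ∈ pBall p n) :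
    |u y - u (rep p n)| ≤ 2 * K * ((p : ℝ) ^ n) ^ (α - γ) := by
  have h1 := hK (rep p n)
  rw [norm_rep] at h1
  have h2 : |u y - u₀| ≤ K * ((p : ℝ) ^ n) ^ (α - γ) :=
    (hK y).trans (mul_le_mul_of_nonneg_left
      (Real.rpow_le_rpow (norm_nonneg _) hy (sub_pos.2 h.hγα).le) hK0)
  calc _ = |(u y - u₀) - (u (rep p n) - u₀)| := by congr 1; ring
    _ ≤ _ := abs_sub _ _
    _ ≤ _ := add_le_add h2 h1
    _ = _ := by ring

theorem integrableOn_sub (h : RadialSolution p α γ M u₀ φ u) (c : ℝ) (n : ℤ) :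
    IntegrableOn (fun y => u y - c) (pBall p n) (haar p) := by
  obtain ⟨K, hK0, hK⟩ := h.exists_abs_sub_le
  have h1 : IntegrableOn (fun y => u y - u (rep p n)) (pBall p n) (haar p) := by
    refine Measure.integrableOn_of_bounded (M := 2 * K * ((p : ℝ) ^ n) ^ (α - γ))
      (haar_pBall_lt_top n).ne (h.isRadial.measurable.sub_const _).aestronglyMeasurable ?_
    filter_upwards [ae_restrict_mem (measurableSet_pBall n)] with y hy
    exact h.abs_sub_rep_le hK0 hK n hy
  have h2 : IntegrableOn (fun _ => u (rep p n) - c) (pBall p n) (haar p) :=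
    integrableOn_const (haar_pBall_lt_top n).ne
  refine (h1.add h2).congr_fun (fun y _ => ?_) (measurableSet_pBall n)
  simp

theorem integrableOn_source (h : RadialSolution p α γ M u₀ φ u) (n : ℤ) :
    IntegrableOn φ (pBall p n) (haar p) :=
  (kernel_integral_succ h.hγ1 h.hγα h.radial.measurable h.bound n).1

theorem zpowBound_source (h : RadialSolution p α γ M u₀ φ u) :
    ZPowBound p (-γ) fun n => φ (rep p n) :=
  ⟨M, fun n => by have := h.bound (rep p n); rwa [norm_rep] at this⟩

theorem zpowBound_integral_source (h : RadialSolution p α γ M u₀ φ u) :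
    ZPowBound p (1 - γ) fun n => ∫ y in pBall p n, φ y ∂(haar p) := by
  refine ⟨M * (qc p / (1 - (p : ℝ) ^ (-(1 - γ)))), fun n => ?_⟩
  obtain ⟨hi, hI⟩ := integral_rpow_pBall (p := p) h.hγ1 n
  refine (norm_integral_le_of_norm_le (f := φ) (hi.const_mul M) (ae_of_all _ h.bound)).trans_eq ?_
  rw [integral_const_mul, hI, mul_assoc]

theorem integral_source_succ (h : RadialSolution p α γ M u₀ φ u) (n : ℤ) :
    ∫ y in pBall p (n + 1), φ y ∂(haar p) =
      ∫ y in pBall p n, φ y ∂(haar p) + qc p * (p : ℝ) ^ (n + 1) * φ (rep p (n + 1)) := by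
  rw [setIntegral_pBall_succ (h.integrableOn_source _), setIntegral_pSphere_of_eq]
  exact fun y hy => h.radial _ _ ((mem_pSphere.1 hy).trans (norm_rep _).symm)

/-- Subtracting the radial forms on neighbouring spheres cancels the full kernel integral; only its
increment survives, multiplied by a plain ball integral of `φ`. -/
theorem sub_succ (h : RadialSolution p α γ M u₀ φ u) (n : ℤ) :
    u (rep p (n + 1)) - u (rep p n) =
      -(1 - (p : ℝ) ^ (-α)) * ((p : ℝ) ^ n) ^ (α - 1) * ∫ y in pBall p n, φ y ∂(haar p) +
        ((p : ℝ) ^ n) ^ α * φ (rep p (n + 1)) -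
        (p : ℝ) ^ (-α) * ((p : ℝ) ^ n) ^ α * φ (rep p n) := by
  have h1 := (fracIntegral_eq h.hγ0.le h.hγ1 h.hγα h.radial h.bound
    (t := rep p (n + 1)) (norm_rep _)).2
  have h2 := (fracIntegral_eq h.hγ0.le h.hγ1 h.hγα h.radial h.bound (n := n - 1)
    (t := rep p n) (by rw [norm_rep, sub_add_cancel])).2
  have h3 := (kernel_integral_succ h.hγ1 h.hγα h.radial.measurable h.bound n).2.2
  have h4 := (kernel_integral_succ h.hγ1 h.hγα h.radial.measurable h.bound (n - 1)).2.1
  have h5 : ((p : ℝ) ^ n) ^ α = (p : ℝ) ^ α * ((p : ℝ) ^ (n - 1)) ^ α := by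
    rw [← zpow_succ_rpow, sub_add_cancel]
  have h6 : ((p : ℝ) ^ (n - 1)) ^ α = (p : ℝ) ^ (-α) * ((p : ℝ) ^ n) ^ α := by
    rw [h5, ← mul_assoc, ← Real.rpow_add prime_pos, neg_add_cancel, Real.rpow_zero, one_mul]
  rw [sub_add_cancel] at h2 h4
  rw [h.eq, h.eq, h1, h2, h3, h4, h6, ← fracConst_mul_fracKernel_sub]
  ring

/-- The outer sphere contributes nothing; on the inner ball only the reference value of `u` changes.
-/
theorem ball_integral_succ (h : RadialSolution p α γ M u₀ φ u) (n : ℤ) :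
    ∫ y in pBall p (n + 1), (u y - u (rep p (n + 1))) ∂(haar p) =
      ∫ y in pBall p n, (u y - u (rep p n)) ∂(haar p) -
        (p : ℝ) ^ n * (u (rep p (n + 1)) - u (rep p n)) := by
  rw [setIntegral_pBall_of_eq_zero (h.integrableOn_sub _ _)]
  · have : ∀ y, u y - u (rep p (n + 1)) =
        (u y - u (rep p n)) - (u (rep p (n + 1)) - u (rep p n)) := fun y => by ring
    simp only [this]
    rw [integral_sub (h.integrableOn_sub _ _) (integrableOn_const (haar_pBall_lt_top n).ne),
      setIntegral_const, haar_real_pBall, smul_eq_mul]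
  · intro y hy
    rw [h.isRadial _ _ ((mem_pSphere.1 hy).trans (norm_rep _).symm), sub_self]

theorem rpow_sub_one_eq (n : ℤ) (α : ℝ) :
    ((p : ℝ) ^ n) ^ (α - 1) = ((p : ℝ) ^ n) ^ α / (p : ℝ) ^ n :=
  Real.rpow_sub_one (zpow_pos prime_pos _).ne' _

/-- The difference of the two sides is invariant under `n ↦ n + 1` by the recursions, and is
`O(p^{n(1+α-γ)})` with `1 + α - γ > 0`. -/
theorem ball_integral_eq (h : RadialSolution p α γ M u₀ φ u) (n : ℤ) :
    ∫ y in pBall p n, (u y - u (rep p n)) ∂(haar p) =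
      -((p : ℝ) ^ (-α) * ((p : ℝ) ^ n) ^ α *
        ((p : ℝ) ^ n * φ (rep p n) - ∫ y in pBall p n, φ y ∂(haar p))) := by
  obtain ⟨K, hK0, hK⟩ := h.exists_abs_sub_le
  have hb : ZPowBound p (1 + α - γ)
      fun n => ∫ y in pBall p n, (u y - u (rep p n)) ∂(haar p) := by
    refine ⟨2 * K, fun n => ?_⟩
    refine (norm_setIntegral_le_of_norm_le_const (f := fun y => u y - u (rep p n))
      (haar_pBall_lt_top n)
      (fun y hy => h.abs_sub_rep_le hK0 hK n hy)).trans_eq ?_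
    rw [haar_real_pBall, show 1 + α - γ = (α - γ) + 1 by ring,
      Real.rpow_add_one (zpow_pos prime_pos _).ne']
    ring
  have hone : ZPowBound p 1 fun n => (p : ℝ) ^ n :=
    (zpowBound_rpow 1).congr rfl fun n => Real.rpow_one _
  have h1 := ((zpowBound_rpow (p := p) α).mul (hone.mul h.zpowBound_source)).const_mul
    ((p : ℝ) ^ (-α))
  have h2 := ((zpowBound_rpow (p := p) α).mul h.zpowBound_integral_source).const_mul
    (-(p : ℝ) ^ (-α))
  have hd := (hb.add ((h1.congr (e' := 1 + α - γ) (by ring) fun n => rfl).add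
    (h2.congr (by ring) fun n => rfl))).eq_zero
    (by have := h.hγ1; have := h.pos; intro h0; linarith) ?_ n
  · linarith
  · intro n
    rw [h.ball_integral_succ, h.integral_source_succ, h.sub_succ, zpow_succ_rpow, rpow_sub_one_eq,
      Real.rpow_neg prime_pos.le, zpow_add_one₀ prime_pos.ne', qc]
    have h3 := (zpow_pos (prime_pos (p := p)) n).ne'
    have h4 := (Real.rpow_pos_of_pos (prime_pos (p := p)) α).ne'
    have h5 := (prime_pos (p := p)).ne'
    field_simp
    ring

theorem pos_of_mem_compl {n : ℤ} {y : ℚ_[p]} (hy : y ∈ (pBall p n)ᶜ) : 0 < ‖y‖ := by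
  rw [Set.mem_compl_iff, mem_pBall, not_le] at hy
  exact (zpow_pos prime_pos _).trans hy

theorem tail_bound {K : ℝ}
    (hK : ∀ t, |u t - u₀| ≤ K * ‖t‖ ^ (α - γ)) (n : ℤ) :
    ∀ᵐ y ∂(haar p).restrict (pBall p n)ᶜ,
      ‖‖y‖ ^ (-α - 1) * (u y - u₀)‖ ≤ K * ‖y‖ ^ (-(1 + γ)) := by
  filter_upwards [ae_restrict_mem (measurableSet_pBall n).compl] with y hy
  have hy0 := pos_of_mem_compl hy
  rw [norm_mul, Real.norm_of_nonneg (by positivity), Real.norm_eq_abs]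
  calc _ ≤ ‖y‖ ^ (-α - 1) * (K * ‖y‖ ^ (α - γ)) :=
        mul_le_mul_of_nonneg_left (hK y) (by positivity)
    _ = _ := by
      rw [show -(1 + γ) = (-α - 1) + (α - γ) by ring, Real.rpow_add hy0]; ring

theorem integrableOn_tail (h : RadialSolution p α γ M u₀ φ u) (n : ℤ) :
    IntegrableOn (fun y => ‖y‖ ^ (-α - 1) * (u y - u₀)) (pBall p n)ᶜ (haar p) := by
  obtain ⟨K, hK0, hK⟩ := h.exists_abs_sub_le
  refine (((integral_rpow_compl_pBall (p := p) (s := 1 + γ) (by linarith [h.hγ0]) n).1.const_mul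
    K).mono' ?_ (tail_bound hK n))
  exact ((measurable_norm.pow_const _).mul
    (h.isRadial.measurable.sub_const _)).aestronglyMeasurable

theorem integral_kernel_compl (hα : 0 < α) (n : ℤ) :
    IntegrableOn (fun y : ℚ_[p] => ‖y‖ ^ (-α - 1)) (pBall p n)ᶜ (haar p) ∧
      ∫ y in (pBall p n)ᶜ, ‖y‖ ^ (-α - 1) ∂(haar p) =
        qc p / (1 - (p : ℝ) ^ (-α)) * ((p : ℝ) ^ (n + 1)) ^ (-α) := by
  have := integral_rpow_compl_pBall (p := p) (s := 1 + α) (by linarith) n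
  simpa only [show -(1 + α) = -α - 1 by ring, add_sub_cancel_left,
    show 1 - (1 + α) = -α by ring] using this

/-- The reference value `u₀`, unlike `u (rep p n)`, does not depend on `n`. This makes the tail
recursion a matter of removing one sphere. -/
theorem integral_tail_eq (h : RadialSolution p α γ M u₀ φ u) (c : ℝ) (n : ℤ) :
    IntegrableOn (fun y => ‖y‖ ^ (-α - 1) * (u y - c)) (pBall p n)ᶜ (haar p) ∧
    ∫ y in (pBall p n)ᶜ, ‖y‖ ^ (-α - 1) * (u y - c) ∂(haar p) =
      ∫ y in (pBall p n)ᶜ, ‖y‖ ^ (-α - 1) * (u y - u₀) ∂(haar p) -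
        (c - u₀) * (qc p / (1 - (p : ℝ) ^ (-α)) * ((p : ℝ) ^ (n + 1)) ^ (-α)) := by
  obtain ⟨hi, hI⟩ := integral_kernel_compl (p := p) h.pos n
  have : ∀ y, ‖y‖ ^ (-α - 1) * (u y - c) =
      ‖y‖ ^ (-α - 1) * (u y - u₀) - (c - u₀) * ‖y‖ ^ (-α - 1) := fun y => by ring
  simp only [this]
  refine ⟨(h.integrableOn_tail n).sub (hi.const_mul _), ?_⟩
  rw [integral_sub (h.integrableOn_tail n) (hi.const_mul _), integral_const_mul, hI]

theorem tail_succ (h : RadialSolution p α γ M u₀ φ u) (n : ℤ) :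
    ∫ y in (pBall p n)ᶜ, ‖y‖ ^ (-α - 1) * (u y - u₀) ∂(haar p) =
      qc p * ((p : ℝ) ^ (n + 1)) ^ (-α) * (u (rep p (n + 1)) - u₀) +
      ∫ y in (pBall p (n + 1))ᶜ, ‖y‖ ^ (-α - 1) * (u y - u₀) ∂(haar p) := by
  have hset : (pBall p n)ᶜ = pSphere p (n + 1) ∪ (pBall p (n + 1))ᶜ := by
    rw [pBall_succ]
    ext y
    have := fun h1 : y ∈ pBall p n => Set.disjoint_left.1 (disjoint_pBall_pSphere n) h1
    simp only [Set.mem_compl_iff, Set.mem_union]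
    tauto
  have hd : Disjoint (pSphere p (n + 1)) (pBall p (n + 1))ᶜ :=
    Set.disjoint_left.2 fun y hy hy' => hy' (pSphere_subset_pBall _ hy)
  have hi := h.integrableOn_tail n
  rw [hset] at hi ⊢
  rw [setIntegral_union hd (measurableSet_pBall _).compl (hi.mono_set Set.subset_union_left)
    (hi.mono_set Set.subset_union_right),
    setIntegral_pSphere_of_eq (c := ((p : ℝ) ^ (n + 1)) ^ (-α - 1) * (u (rep p (n + 1)) - u₀)),
    Real.rpow_sub_one (zpow_pos prime_pos _).ne']
  · have h3 := (zpow_pos (prime_pos (p := p)) (n + 1)).ne'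
    field_simp
  · intro y hy
    rw [mem_pSphere.1 hy, h.isRadial _ _ ((mem_pSphere.1 hy).trans (norm_rep _).symm)]

theorem rpow_neg_ne_one (hα : 0 < α) : 1 - (p : ℝ) ^ (-α) ≠ 0 :=
  (sub_pos.2 (rpow_neg_lt_one hα)).ne'

/-- Every term is `O(p^{-nγ})`, so the vanishing argument applies because `γ > 0`. -/
theorem tail_integral_eq (h : RadialSolution p α γ M u₀ φ u) (n : ℤ) :
    ∫ y in (pBall p n)ᶜ, ‖y‖ ^ (-α - 1) * (u y - u (rep p n)) ∂(haar p) =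
      -((p : ℝ) ^ (-α) * ((p : ℝ) ^ n)⁻¹ * ∫ y in pBall p n, φ y ∂(haar p)) -
        qc p * ((p : ℝ) ^ (-α)) ^ 2 / (1 - (p : ℝ) ^ (-α)) * φ (rep p n) := by
  obtain ⟨K, hK0, hK⟩ := h.exists_abs_sub_le
  have hb1 : ZPowBound p (-γ)
      fun n => ∫ y in (pBall p n)ᶜ, ‖y‖ ^ (-α - 1) * (u y - u₀) ∂(haar p) := by
    refine ⟨K * (qc p / (1 - (p : ℝ) ^ (-γ)) * (p : ℝ) ^ (-γ)), fun n => ?_⟩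
    obtain ⟨hi, hI⟩ := integral_rpow_compl_pBall (p := p) (s := 1 + γ) (by linarith [h.hγ0]) n
    refine (norm_integral_le_of_norm_le (hi.const_mul K) (tail_bound hK n)).trans_eq ?_
    rw [integral_const_mul, hI, add_sub_cancel_left, show 1 - (1 + γ) = -γ by ring, zpow_succ_rpow]
    ring
  have hb2 : ZPowBound p (α - γ) fun n => u (rep p n) - u₀ :=
    ⟨K, fun n => by have := hK (rep p n); rwa [norm_rep] at this⟩
  have h1 := (hb2.mul (zpowBound_rpow (p := p) (-α))).const_mul
    (-(qc p / (1 - (p : ℝ) ^ (-α)) * (p : ℝ) ^ (-α)))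
  have h2 := (h.zpowBound_integral_source.mul (zpowBound_rpow (p := p) (-1))).const_mul
    ((p : ℝ) ^ (-α))
  have h3 := h.zpowBound_source.const_mul (qc p * ((p : ℝ) ^ (-α)) ^ 2 / (1 - (p : ℝ) ^ (-α)))
  have hd := (((hb1.add (h1.congr (e' := -γ) (by ring) fun n => rfl)).add
    (h2.congr (by ring) fun n => rfl)).add h3).eq_zero (by have := h.hγ0; intro h0; linarith) ?_ n
  · rw [(h.integral_tail_eq _ n).2, zpow_succ_rpow]
    rw [Real.rpow_neg_one] at hd
    linear_combination hd
  · intro n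
    have hs : u (rep p (n + 1)) = u (rep p n) + (u (rep p (n + 1)) - u (rep p n)) := by ring
    rw [h.tail_succ n, h.integral_source_succ, hs, h.sub_succ, zpow_succ_rpow, rpow_sub_one_eq,
      Real.rpow_neg_one, Real.rpow_neg_one, Real.rpow_neg (zpow_pos prime_pos _).le,
      zpow_add_one₀ prime_pos.ne', qc]
    have h3 := (zpow_pos (prime_pos (p := p)) n).ne'
    have h4 : ((p : ℝ) ^ n) ^ α ≠ 0 := (Real.rpow_pos_of_pos (zpow_pos prime_pos n) α).ne'
    have h5 := (prime_pos (p := p)).ne'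
    have h6 := rpow_neg_ne_one (p := p) h.pos
    generalize (p : ℝ) ^ (-α) = b at *
    generalize ((p : ℝ) ^ n) ^ α = X at *
    generalize (p : ℝ) ^ n = x at *
    field_simp
    ring

/-- `D^α` is inverse to `I^α` on radial functions. -/
theorem vladimirov_eq (h : RadialSolution p α γ M u₀ φ u) {t : ℚ_[p]} (ht : t ≠ 0) :
    VladimirovExistsAt α u t ∧ vladimirov α u t = φ t := by
  obtain ⟨n, hn⟩ := exists_norm_eq_zpow ht
  have hut : u t = u (rep p n) := h.isRadial _ _ (hn.trans (norm_rep n).symm)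
  have htb : t ∈ pBall p n := hn.le
  obtain ⟨hi1, hI1⟩ := integrableOn_pBall_sub htb (h.integrableOn_sub (u (rep p n)) n)
  obtain ⟨hi2, -⟩ := h.integral_tail_eq (u (rep p n)) n
  -- For `|y| < |t|` the increment of `u` vanishes, so the factor `|y|^{-α-1}` may be frozen at its
  -- value on the sphere `|y| = |t|`.
  have he1 : Set.EqOn (vladimirovIntegrand α u t)
      (fun y => ((p : ℝ) ^ n) ^ (-α - 1) * (u (t - y) - u (rep p n))) (pBall p n) := by
    intro y hy
    simp only [vladimirovIntegrand, ← hut]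
    rcases (show ‖y‖ ≤ ‖t‖ by rw [hn]; exact hy).lt_or_eq with hlt | heq
    · rw [h.isRadial _ _ (norm_sub_eq_of_lt hlt), sub_self, mul_zero, mul_zero]
    · rw [heq, hn]
  -- Outside the ball `|t - y| = |y|`, so the shift disappears.
  have he2 : Set.EqOn (vladimirovIntegrand α u t)
      (fun y => ‖y‖ ^ (-α - 1) * (u y - u (rep p n))) (pBall p n)ᶜ := by
    intro y hy
    rw [Set.mem_compl_iff, mem_pBall, ← hn, not_le] at hy
    simp only [vladimirovIntegrand, ← hut]
    rw [h.isRadial (t - y) y]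
    rw [norm_sub_rev]; exact norm_sub_eq_of_lt hy
  have hj1 := (integrableOn_congr_fun he1 (measurableSet_pBall n)).2
    (hi1.const_mul (((p : ℝ) ^ n) ^ (-α - 1)))
  have hj2 := (integrableOn_congr_fun he2 (measurableSet_pBall n).compl).2 hi2
  have hj : Integrable (vladimirovIntegrand α u t) (haar p) := by
    rw [← integrableOn_univ, ← Set.union_compl_self (pBall p n)]
    exact hj1.union hj2
  refine ⟨hj, ?_⟩
  rw [vladimirov, ← integral_add_compl (measurableSet_pBall n) hj,
    setIntegral_congr_fun (measurableSet_pBall n) he1,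
    setIntegral_congr_fun (measurableSet_pBall n).compl he2, integral_const_mul, hI1,
    h.ball_integral_eq, h.tail_integral_eq, h.radial t (rep p n) (hn.trans (norm_rep n).symm),
    Real.rpow_sub_one (zpow_pos prime_pos _).ne', Real.rpow_sub_one prime_pos.ne',
    Real.rpow_neg (zpow_pos prime_pos _).le, qc]
  have h3 := (zpow_pos (prime_pos (p := p)) n).ne'
  have h4 : ((p : ℝ) ^ n) ^ α ≠ 0 := (Real.rpow_pos_of_pos (zpow_pos prime_pos n) α).ne'
  have h5 := (prime_pos (p := p)).ne'
  have h6 := rpow_neg_ne_one (p := p) h.pos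
  have h7 : (p : ℝ) ^ α = ((p : ℝ) ^ (-α))⁻¹ := by rw [Real.rpow_neg prime_pos.le, inv_inv]
  have h8 : (p : ℝ) ^ (-α) ≠ 0 := (Real.rpow_pos_of_pos prime_pos _).ne'
  have h9 : (p : ℝ) - (p : ℝ) ^ (-α) ≠ 0 := by
    have := rpow_neg_lt_one (p := p) h.pos
    have := one_lt_prime (p := p)
    intro h0; linarith
  rw [h7]
  -- What remains is a rational identity: the two integrals of `φ` cancel, and the coefficient of
  -- `φ(t)` becomes `-b(1 - b/p)/(1 - b)`, the inverse of the prefactor of `D^α`.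
  generalize (p : ℝ) ^ (-α) = b at *
  generalize ((p : ℝ) ^ n) ^ α = X at *
  generalize (p : ℝ) ^ n = x at *
  have h10 : 1 - b / (p : ℝ) ≠ 0 := by
    rw [one_sub_div h5]; exact div_ne_zero h9 h5
  field_simp
  ring

end RadialSolution

end

/-! ### From the iteration and continuation to the integral equation. -/

noncomputable section

variable {p : ℕ} [hp : Fact p.Prime]

theorem isRadial_fTilde (γ : ℝ) (f : ℝ → ℝ → ℝ) {u : ℚ_[p] → ℝ} (hu : IsRadial u) :
    IsRadial (fTilde γ f u) := fun s t h => by simp only [fTilde, h, hu s t h]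

theorem fTilde_zero {γ : ℝ} (hγ : 0 < γ) (f : ℝ → ℝ → ℝ) (u : ℚ_[p] → ℝ) :
    fTilde γ f u 0 = 0 := by
  simp [fTilde, Real.zero_rpow (neg_ne_zero.2 hγ.ne')]

theorem powerBound_fTilde {γ M : ℝ} (hγ : 0 < γ) {f : ℝ → ℝ → ℝ}
    (hM : ∀ (ℓ : ℤ) (x : ℝ), |f ((p : ℝ) ^ ℓ) x| ≤ M) (u : ℚ_[p] → ℝ) :
    PowerBound M γ (fTilde γ f u) := by
  intro y
  rcases eq_or_ne y 0 with rfl | hy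
  · rw [fTilde_zero hγ, norm_zero, Real.zero_rpow (neg_ne_zero.2 hγ.ne')]; simp
  · obtain ⟨n, hn⟩ := exists_norm_eq_zpow hy
    rw [fTilde, abs_mul, abs_of_nonneg (by positivity), mul_comm]
    refine mul_le_mul_of_nonneg_right ?_ (by positivity)
    rw [hn]; exact hM n _

theorem isRadial_picard {α γ M : ℝ} (hγ0 : 0 < γ) (hγ1 : γ < 1) (hγα : γ < α) {f : ℝ → ℝ → ℝ}
    (hM : ∀ (ℓ : ℤ) (x : ℝ), |f ((p : ℝ) ^ ℓ) x| ≤ M) (u₀ : ℝ) (k : ℕ) :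
    IsRadial (picard p α γ f u₀ k) := by
  induction k with
  | zero => exact fun _ _ _ => rfl
  | succ k ih =>
    intro s t hst
    simp only [picard]
    rw [isRadial_fracIntegral hγ0.le hγ1 hγα (isRadial_fTilde γ f ih) (powerBound_fTilde hγ0 hM _)
      s t hst]

theorem fracIntegral_congr {α : ℝ} {φ ψ : ℚ_[p] → ℝ} {t : ℚ_[p]}
    (h : ∀ y, ‖y‖ ≤ ‖t‖ → φ y = ψ y) : fracIntegral α φ t = fracIntegral α ψ t := by
  rw [fracIntegral, fracIntegral]
  congr 1
  refine setIntegral_congr_fun (measurableSet_le measurable_norm measurable_const) fun y hy => ?_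
  simp only [fracIntegrand, h y hy]

theorem fracIntegral_sub {α : ℝ} {φ ψ : ℚ_[p] → ℝ} {t : ℚ_[p]}
    (hφ : FracIntegralExistsAt α φ t) (hψ : FracIntegralExistsAt α ψ t) :
    fracIntegral α φ t - fracIntegral α ψ t = fracIntegral α (fun y => φ y - ψ y) t := by
  rw [fracIntegral, fracIntegral, fracIntegral, ← mul_sub, ← integral_sub hφ hψ]
  congr 2
  funext y
  simp only [fracIntegrand]; ring

/-- Dominated convergence: the majorant is the integrand for the extremal source `M|y|^{-γ}`, itself
radial and admissible. -/
theorem tendsto_fracIntegral {α γ M : ℝ} (hγ0 : 0 < γ) (hγ1 : γ < 1) (hγα : γ < α)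
    {φ : ℕ → ℚ_[p] → ℝ} {ψ : ℚ_[p] → ℝ} (hφr : ∀ k, IsRadial (φ k))
    (hφ : ∀ k, PowerBound M γ (φ k)) {t : ℚ_[p]}
    (hlim : ∀ y, ‖y‖ ≤ ‖t‖ → Tendsto (fun k => φ k y) atTop (𝓝 (ψ y))) :
    Tendsto (fun k => fracIntegral α (φ k) t) atTop (𝓝 (fracIntegral α ψ t)) := by
  refine Tendsto.const_mul _ ?_
  have hM := (hφ 0).nonneg
  have hbr : IsRadial (p := p) fun y => M * ‖y‖ ^ (-γ) := fun s t h => by simp only [h]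
  have hb : PowerBound (p := p) M γ fun y => M * ‖y‖ ^ (-γ) := fun y => by
    rw [abs_of_nonneg (by positivity)]
  refine tendsto_integral_of_dominated_convergence
    (fun y => ‖fracIntegrand α (fun y : ℚ_[p] => M * ‖y‖ ^ (-γ)) t y‖) (fun k => ?_)
    (fracIntegral_existsAt hγ0.le hγ1 hγα hbr hb t).norm (fun k => ae_of_all _ fun y => ?_) ?_
  · exact (fracIntegral_existsAt hγ0.le hγ1 hγα (hφr k) (hφ k) t).aestronglyMeasurable
  · simp only [fracIntegrand, norm_mul]
    refine mul_le_mul_of_nonneg_left ?_ (norm_nonneg _)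
    rw [← norm_mul]
    exact (hφ k y).trans (le_abs_self _)
  · filter_upwards [ae_restrict_mem (measurableSet_le measurable_norm measurable_const)] with y hy
    exact (hlim y hy).const_mul _

theorem continuous_of_abs_sub_le {g : ℝ → ℝ} {K : ℝ} (h : ∀ x y, |g x - g y| ≤ K * |x - y|) :
    Continuous g :=
  (LipschitzWith.of_dist_le' (K := K) fun x y => by
    simpa only [Real.dist_eq] using h x y).continuous

theorem tendsto_fTilde {γ : ℝ} (hγ : 0 < γ) {f : ℝ → ℝ → ℝ}
    (hf : ∀ ℓ : ℤ, Continuous (f ((p : ℝ) ^ ℓ))) {v : ℕ → ℚ_[p] → ℝ} {u : ℚ_[p] → ℝ} {y : ℚ_[p]}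
    (h : Tendsto (fun k => v k y) atTop (𝓝 (u y))) :
    Tendsto (fun k => fTilde γ f (v k) y) atTop (𝓝 (fTilde γ f u y)) := by
  rcases eq_or_ne y 0 with rfl | hy
  · simp only [fTilde_zero hγ]; exact tendsto_const_nhds
  · obtain ⟨n, hn⟩ := exists_norm_eq_zpow hy
    refine Tendsto.const_mul _ ?_
    rw [hn]
    exact ((hf n).tendsto _).comp h

theorem zpow_rpow_comm (n : ℤ) (a : ℝ) : ((p : ℝ) ^ n) ^ a = (p : ℝ) ^ (a * (n : ℝ)) := by
  rw [← Real.rpow_intCast, ← Real.rpow_mul prime_pos.le, mul_comm]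

/-- Inside the starting ball the recursion passes to the limit; outside it, the continuation
equation is the radial form of `I^α` at `ℓ = m - 1`. -/
theorem IsObtainedByIterationAndContinuation.eq {α γ M u₀ : ℝ} (hγ0 : 0 < γ) (hγ1 : γ < 1)
    (hγα : γ < α) {f : ℝ → ℝ → ℝ} (hM : ∀ (ℓ : ℤ) (x : ℝ), |f ((p : ℝ) ^ ℓ) x| ≤ M)
    (hf : ∀ ℓ : ℤ, Continuous (f ((p : ℝ) ^ ℓ))) {u : ℚ_[p] → ℝ}
    (hu : IsObtainedByIterationAndContinuation α γ f u₀ u) (t : ℚ_[p]) :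
    u t = u₀ + fracIntegral α (fTilde γ f u) t := by
  obtain ⟨hur, N, hunif, hcont⟩ := hu
  rcases le_or_gt ‖t‖ ((p : ℝ) ^ N) with ht | ht
  · have h1 := hunif.tendsto_at (x := t) ht
    have h2 : Tendsto (fun k => picard p α γ f u₀ (k + 1) t) atTop
        (𝓝 (u₀ + fracIntegral α (fTilde γ f u) t)) :=
      (tendsto_fracIntegral hγ0 hγ1 hγα
        (fun k => isRadial_fTilde γ f (isRadial_picard hγ0 hγ1 hγα hM u₀ k))
        (fun k => powerBound_fTilde hγ0 hM _)
        (fun y hy => tendsto_fTilde hγ0 hf (hunif.tendsto_at (x := y) (hy.trans ht)))).const_add u₀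
    exact tendsto_nhds_unique ((tendsto_add_atTop_iff_nat 1).2 h1) h2
  · have ht0 : t ≠ 0 := norm_pos_iff.1 ((zpow_pos prime_pos _).trans ht)
    obtain ⟨m, hm⟩ := exists_norm_eq_zpow ht0
    rw [hm] at ht
    have hNm : N < m := (zpow_lt_zpow_iff_right₀ one_lt_prime).1 ht
    rw [← sub_add_cancel m 1] at hm
    rw [hcont (m - 1) (by omega) t hm, (fracIntegral_eq hγ0.le hγ1 hγα (isRadial_fTilde γ f hur)
      (powerBound_fTilde hγ0 hM u) hm).2, contConst, zpow_rpow_comm, add_assoc]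
    rfl

/-! ### Existence: contraction on a small ball and continuation. -/

theorem abs_fTilde_sub_le {γ F : ℝ} (hγ : 0 < γ) {f : ℝ → ℝ → ℝ}
    (hF : ∀ (ℓ : ℤ) (x y : ℝ), |f ((p : ℝ) ^ ℓ) x - f ((p : ℝ) ^ ℓ) y| ≤ F * |x - y|)
    (v w : ℚ_[p] → ℝ) (y : ℚ_[p]) :
    |fTilde γ f v y - fTilde γ f w y| ≤ F * |v y - w y| * ‖y‖ ^ (-γ) := by
  rcases eq_or_ne y 0 with rfl | hy
  · rw [fTilde_zero hγ, fTilde_zero hγ, norm_zero, Real.zero_rpow (neg_ne_zero.2 hγ.ne')]; simp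
  · obtain ⟨n, hn⟩ := exists_norm_eq_zpow hy
    rw [fTilde, fTilde, ← mul_sub, abs_mul, abs_of_nonneg (by positivity), mul_comm]
    refine mul_le_mul_of_nonneg_right ?_ (by positivity)
    rw [hn]; exact hF n _ _

/-- The difference of the sources, truncated to the ball, has power bound `Fδ` everywhere, so the
uniform estimate for `I^α` applies. Truncation is harmless since `I^α` at `t` sees only `|y| ≤ |t|`.
-/
theorem exists_abs_fracIntegral_fTilde_sub_le {α γ M F : ℝ} (hγ0 : 0 < γ) (hγ1 : γ < 1)
    (hγα : γ < α) {f : ℝ → ℝ → ℝ} (hM : ∀ (ℓ : ℤ) (x : ℝ), |f ((p : ℝ) ^ ℓ) x| ≤ M)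
    (hF : ∀ (ℓ : ℤ) (x y : ℝ), |f ((p : ℝ) ^ ℓ) x - f ((p : ℝ) ^ ℓ) y| ≤ F * |x - y|) :
    ∃ C : ℝ, ∀ (N : ℤ) (δ : ℝ) (v w : ℚ_[p] → ℝ), IsRadial v → IsRadial w →
      (∀ y ∈ pBall p N, |v y - w y| ≤ δ) → ∀ t ∈ pBall p N,
        |fracIntegral α (fTilde γ f v) t - fracIntegral α (fTilde γ f w) t| ≤
          C * ((p : ℝ) ^ N) ^ (α - γ) * δ := by
  obtain ⟨C, hC0, hC⟩ := exists_abs_fracIntegral_le (p := p) hγ0.le hγ1 hγα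
  have hF0 : 0 ≤ F := by
    have := (abs_nonneg _).trans (hF 0 1 0)
    simpa using this
  refine ⟨C * F, fun N δ v w hv hw hδ t ht => ?_⟩
  have hδ0 : 0 ≤ δ := (abs_nonneg _).trans (hδ t ht)
  have hv' := isRadial_fTilde γ f hv
  have hw' := isRadial_fTilde γ f hw
  rw [fracIntegral_sub
    (fracIntegral_existsAt hγ0.le hγ1 hγα hv' (powerBound_fTilde hγ0 hM v) t)
    (fracIntegral_existsAt hγ0.le hγ1 hγα hw' (powerBound_fTilde hγ0 hM w) t),
    fracIntegral_congr (ψ := fun y => if ‖y‖ ≤ (p : ℝ) ^ N then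
      fTilde γ f v y - fTilde γ f w y else 0) fun y hy => (if_pos (hy.trans ht)).symm]
  refine (hC (F * δ) _ ?_ ?_ t).trans ?_
  · intro s t hst
    simp only [hst, hv' s t hst, hw' s t hst]
  · intro y
    beta_reduce
    split_ifs with hy
    · refine (abs_fTilde_sub_le hγ0 hF v w y).trans ?_
      have := hδ y hy
      gcongr
    · rw [abs_zero]; positivity
  · have : ‖t‖ ^ (α - γ) ≤ ((p : ℝ) ^ N) ^ (α - γ) :=
      Real.rpow_le_rpow (norm_nonneg _) ht (sub_pos.2 hγα).le
    calc _ ≤ C * (F * δ) * ((p : ℝ) ^ N) ^ (α - γ) := by gcongr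
      _ = _ := by ring

/-- Local solvability: the successive approximations converge uniformly on some ball. -/
theorem exists_tendstoUniformlyOn_picard {α γ M F : ℝ} (hγ0 : 0 < γ) (hγ1 : γ < 1)
    (hγα : γ < α) {f : ℝ → ℝ → ℝ} (hM : ∀ (ℓ : ℤ) (x : ℝ), |f ((p : ℝ) ^ ℓ) x| ≤ M)
    (hF : ∀ (ℓ : ℤ) (x y : ℝ), |f ((p : ℝ) ^ ℓ) x - f ((p : ℝ) ^ ℓ) y| ≤ F * |x - y|) (u₀ : ℝ) :
    ∃ (N : ℤ) (v : ℚ_[p] → ℝ), IsRadial v ∧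
      TendstoUniformlyOn (picard p α γ f u₀) v atTop (pBall p N) := by
  obtain ⟨C, hC⟩ := exists_abs_fracIntegral_fTilde_sub_le hγ0 hγ1 hγα hM hF
  -- As `α > γ`, shrinking the ball makes the Lipschitz constant at most `1/2`; `D` below bounds the
  -- first iteration step.
  obtain ⟨N, hN⟩ : ∃ N : ℤ, C * ((p : ℝ) ^ N) ^ (α - γ) ≤ 1 / 2 := by
    have h1 := (tendsto_pow_atTop_nhds_zero_of_lt_one (Real.rpow_nonneg prime_pos.le _)
      (rpow_neg_lt_one (p := p) (sub_pos.2 hγα))).const_mul C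
    rw [mul_zero] at h1
    obtain ⟨j, hj⟩ := (h1.eventually_le_const (by norm_num : (0 : ℝ) < 1 / 2)).exists
    exact ⟨-j, by rwa [zpow_neg_natCast_rpow]⟩
  obtain ⟨C', hC'0, hC'⟩ := exists_abs_fracIntegral_le (p := p) hγ0.le hγ1 hγα
  have hrad := isRadial_picard hγ0 hγ1 hγα hM u₀
  have hM0 : 0 ≤ M := (abs_nonneg _).trans (hM 0 0)
  set D := C' * M * ((p : ℝ) ^ N) ^ (α - γ)
  have hstep : ∀ k, ∀ t ∈ pBall p N,
      |picard p α γ f u₀ k t - picard p α γ f u₀ (k + 1) t| ≤ D * (1 / 2) ^ k := by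
    intro k
    induction k with
    | zero =>
      intro t ht
      simp only [picard, sub_add_cancel_left, abs_neg, pow_zero, mul_one]
      refine (hC' M _ (isRadial_fTilde γ f (hrad 0)) (powerBound_fTilde hγ0 hM _) t).trans ?_
      exact mul_le_mul_of_nonneg_left
        (Real.rpow_le_rpow (norm_nonneg _) ht (sub_pos.2 hγα).le) (mul_nonneg hC'0 hM0)
    | succ k ih =>
      intro t ht
      have h1 := hC N _ _ _ (hrad k) (hrad (k + 1)) ih t ht
      have h2 : 0 ≤ D * (1 / 2) ^ k := (abs_nonneg _).trans (ih t ht)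
      calc |picard p α γ f u₀ (k + 1) t - picard p α γ f u₀ (k + 1 + 1) t|
          = |fracIntegral α (fTilde γ f (picard p α γ f u₀ k)) t -
              fracIntegral α (fTilde γ f (picard p α γ f u₀ (k + 1))) t| := by
            simp only [picard]; congr 1; ring
        _ ≤ _ := h1
        _ ≤ 1 / 2 * (D * (1 / 2) ^ k) := mul_le_mul_of_nonneg_right hN h2
        _ = _ := by ring
  have hlim : ∀ t, ∃ a, t ∈ pBall p N →
      Tendsto (fun k => picard p α γ f u₀ k t) atTop (𝓝 a) := by
    intro t
    by_cases ht : t ∈ pBall p N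
    · obtain ⟨a, ha⟩ := cauchySeq_tendsto_of_complete
        (cauchySeq_of_le_geometric (f := fun k => picard p α γ f u₀ k t) (1 / 2) D (by norm_num)
          fun k => hstep k t ht)
      exact ⟨a, fun _ => ha⟩
    · exact ⟨0, fun h => absurd h ht⟩
  choose v hv using hlim
  refine ⟨N, fun t => if ‖t‖ ≤ (p : ℝ) ^ N then v t else 0, fun s t hst => ?_, ?_⟩
  · simp only [hst]
    split_ifs with ht
    · have h1 := hv s (hst.trans_le ht)
      simp only [hrad _ s t hst] at h1
      exact tendsto_nhds_unique h1 (hv t ht)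
    · rfl
  · rw [Metric.tendstoUniformlyOn_iff]
    intro ε hε
    have h1 := ((tendsto_pow_atTop_nhds_zero_of_lt_one (by norm_num : (0 : ℝ) ≤ 1 / 2)
      (by norm_num)).const_mul D).div_const (1 - 1 / 2)
    rw [mul_zero, zero_div] at h1
    filter_upwards [h1.eventually_lt_const hε] with k hk t ht
    rw [if_pos (mem_pBall.1 ht), dist_comm]
    exact (dist_le_of_le_geometric_of_tendsto (1 / 2) D (by norm_num)
      (fun k => hstep k t ht) (hv t ht) k).trans_lt hk

/-- Successive extension of a radial function from the ball of radius `p ^ N` to larger balls. -/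
def radialExtend (N : ℤ) (v : ℚ_[p] → ℝ) (root : ℤ → (ℚ_[p] → ℝ) → ℝ) : ℕ → ℚ_[p] → ℝ
  | 0 => v
  | k + 1 => fun t =>
      if ‖t‖ = (p : ℝ) ^ (N + k + 1) then root (N + k) (radialExtend N v root k)
      else radialExtend N v root k t

/-- Because `root ℓ` depends only on values in the ball of radius `p^ℓ`, already final at that
stage, the stagewise extensions glue to one function. -/
theorem exists_radial_extension {N : ℤ} {v : ℚ_[p] → ℝ} (hv : IsRadial v)
    {root : ℤ → (ℚ_[p] → ℝ) → ℝ}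
    (hroot : ∀ ℓ v w, Set.EqOn v w (pBall p ℓ) → root ℓ v = root ℓ w) :
    ∃ u : ℚ_[p] → ℝ, IsRadial u ∧ Set.EqOn u v (pBall p N) ∧
      ∀ ℓ, N ≤ ℓ → ∀ t ∈ pSphere p (ℓ + 1), u t = root ℓ u := by
  have hr : ∀ k, IsRadial (radialExtend N v root k) := by
    intro k
    induction k with
    | zero => exact hv
    | succ k ih =>
      intro s t hst
      simp only [radialExtend, hst, ih s t hst]
  have hstep : ∀ k : ℕ, ∀ t ∈ pBall p (N + k),
      radialExtend N v root (k + 1) t = radialExtend N v root k t := by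
    intro k t ht
    simp only [radialExtend]
    rw [if_neg (norm_lt_zpow_succ.2 ht).ne]
  have hmono : ∀ j k : ℕ, ∀ t ∈ pBall p (N + k),
      radialExtend N v root (k + j) t = radialExtend N v root k t := by
    intro j k t ht
    induction j with
    | zero => rfl
    | succ j ih =>
      rw [← ih]
      refine hstep (k + j) t (mem_pBall.2 ((mem_pBall.1 ht).trans ?_))
      rw [zpow_le_zpow_iff_prime]; push_cast; omega
  have hex : ∀ t : ℚ_[p], ∃ k : ℕ, t ∈ pBall p (N + k) := by
    intro t
    rcases eq_or_ne t 0 with rfl | ht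
    · exact ⟨0, by rw [mem_pBall, norm_zero]; exact (zpow_pos prime_pos _).le⟩
    · obtain ⟨m, hm⟩ := exists_norm_eq_zpow ht
      refine ⟨(m - N).toNat, ?_⟩
      rw [mem_pBall, hm, zpow_le_zpow_iff_prime]; omega
  choose K hK using hex
  have hu : ∀ k : ℕ, ∀ t ∈ pBall p (N + k),
      radialExtend N v root (K t) t = radialExtend N v root k t := by
    intro k t ht
    -- Both stages are compared with the common later stage `K t + k`, so the choice of `K t` is
    -- immaterial.
    rw [← hmono k (K t) t (hK t), add_comm, hmono (K t) k t ht]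
  refine ⟨fun t => radialExtend N v root (K t) t, fun s t hst => ?_, fun t ht => ?_, ?_⟩
  · have : t ∈ pBall p (N + K s) := hst.symm.trans_le (hK s)
    simp only [hu (K s) t this, hr _ s t hst]
  · exact hu 0 t (by simpa using ht)
  · intro ℓ hℓ t ht
    obtain ⟨k, rfl⟩ : ∃ k : ℕ, ℓ = N + k := ⟨(ℓ - N).toNat, by omega⟩
    have h1 := hu (k + 1) t (by
      rw [mem_pBall, mem_pSphere.1 ht]; push_cast; rw [add_assoc])
    simp only [h1, radialExtend]
    rw [if_pos (mem_pSphere.1 ht)]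
    exact hroot _ _ _ fun y hy => (hu k y hy).symm

/-- `x - a g(x)` differs from `x` by at most `|a|M`, so it lies on either side of `c` at `c ± |a|M`,
and the intermediate value theorem applies. -/
theorem exists_root {g : ℝ → ℝ} (hg : Continuous g) {M : ℝ} (hM : ∀ x, |g x| ≤ M) (a c : ℝ) :
    ∃ x, x = c + a * g x := by
  have hb : ∀ x, |a * g x| ≤ |a| * M := fun x => by
    rw [abs_mul]; exact mul_le_mul_of_nonneg_left (hM x) (abs_nonneg _)
  obtain ⟨x, hx⟩ := mem_range_of_exists_le_of_exists_ge (c := c)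
    (f := fun x => x - a * g x) (by fun_prop)
    ⟨c - |a| * M, by
      have := (abs_le.1 (hb (c - |a| * M))).1
      linarith⟩
    ⟨c + |a| * M, by
      have := (abs_le.1 (hb (c + |a| * M))).2
      linarith⟩
  exact ⟨x, by linarith⟩

theorem contConst_congr {α γ : ℝ} {f : ℝ → ℝ → ℝ} {u v : ℚ_[p] → ℝ} {ℓ : ℤ}
    (h : Set.EqOn u v (pBall p ℓ)) : contConst α γ f u ℓ = contConst α γ f v ℓ := by
  rw [contConst, contConst]
  congr 1
  refine setIntegral_congr_fun (measurableSet_pBall ℓ) fun y hy => ?_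
  simp only [fTilde, h hy]

theorem exists_isObtainedByIterationAndContinuation {α γ M F : ℝ} (hγ0 : 0 < γ) (hγ1 : γ < 1)
    (hγα : γ < α) {f : ℝ → ℝ → ℝ} (hM : ∀ (ℓ : ℤ) (x : ℝ), |f ((p : ℝ) ^ ℓ) x| ≤ M)
    (hF : ∀ (ℓ : ℤ) (x y : ℝ), |f ((p : ℝ) ^ ℓ) x - f ((p : ℝ) ^ ℓ) y| ≤ F * |x - y|) (u₀ : ℝ) :
    ∃ u : ℚ_[p] → ℝ, IsObtainedByIterationAndContinuation α γ f u₀ u := by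
  obtain ⟨N, v, hv, hunif⟩ := exists_tendstoUniformlyOn_picard hγ0 hγ1 hγα hM hF u₀
  have hex : ∀ (ℓ : ℤ) (c : ℝ), ∃ x, x = c +
      ((p : ℝ) ^ (α * (ℓ : ℝ)) * ((p : ℝ) ^ (ℓ + 1)) ^ (-γ)) * f ((p : ℝ) ^ (ℓ + 1)) x :=
    fun ℓ c => exists_root (continuous_of_abs_sub_le (hF (ℓ + 1))) (hM (ℓ + 1)) _ c
  -- The root is chosen as a function of `ℓ` and the additive constant alone, so it depends on `u`
  -- only through its values in the ball.
  choose R hR using hex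
  obtain ⟨u, hur, huv, hus⟩ := exists_radial_extension (N := N) hv
    (root := fun ℓ w => R ℓ (u₀ + contConst α γ f w ℓ))
    (fun ℓ w w' h => by rw [contConst_congr h])
  refine ⟨u, hur, N, hunif.congr_right huv.symm, fun ℓ hℓ t ht => ?_⟩
  have h1 := hR ℓ (u₀ + contConst α γ f u ℓ)
  rw [← hus ℓ hℓ t ht, mul_assoc] at h1
  rw [fTilde, ht]
  exact h1

end
end PadicRadial

theorem theorem3 (p : ℕ) [Fact p.Prime] (α γ β M A u₀ : ℝ) (Fl : ℤ → ℝ) (f : ℝ → ℝ → ℝ)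
    (hα : 0 < α) (hγ : 0 < γ) (hγα : γ < min 1 α)
    (hM : ∀ (ℓ : ℤ) (x : ℝ), |f ((p : ℝ) ^ ℓ) x| ≤ M)
    (hFl : ∀ ℓ : ℤ, 0 < Fl ℓ ∧ Fl ℓ < (p : ℝ) ^ (-α * (ℓ : ℝ)))
    (hLip : ∀ (ℓ : ℤ) (x y : ℝ),
      |f ((p : ℝ) ^ ℓ) x - f ((p : ℝ) ^ ℓ) y| ≤ Fl ℓ * |x - y|)
    (hβ : α < β + γ)
    (hA : ∀ (ℓ : ℤ) (x : ℝ), 1 ≤ ℓ → |f ((p : ℝ) ^ ℓ) x| ≤ A * (p : ℝ) ^ (-β * (ℓ : ℝ))) :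
    (∀ u : ℚ_[p] → ℝ, PadicRadial.IsObtainedByIterationAndContinuation α γ f u₀ u →
      PadicRadial.IsGlobalMildSolution α γ f u₀ u ∧ u 0 = u₀ ∧
      ∀ t : ℚ_[p], t ≠ 0 →
        PadicRadial.VladimirovExistsAt α u t ∧
        ‖t‖ ^ γ * PadicRadial.vladimirov α u t = f ‖t‖ (u t)) ∧
    ((∃ F : ℝ, ∀ (ℓ : ℤ) (x y : ℝ),
        |f ((p : ℝ) ^ ℓ) x - f ((p : ℝ) ^ ℓ) y| ≤ F * |x - y|) →
      ∃ u : ℚ_[p] → ℝ, PadicRadial.IsObtainedByIterationAndContinuation α γ f u₀ u) := by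
  have hγ1 : γ < 1 := hγα.trans_le (min_le_left _ _)
  have hγα' : γ < α := hγα.trans_le (min_le_right _ _)
  refine ⟨fun u hu => ?_, fun ⟨F, hF⟩ =>
    PadicRadial.exists_isObtainedByIterationAndContinuation hγ hγ1 hγα' hM hF u₀⟩
  -- Continuity of each `f(p^ℓ, ·)` carries pointwise convergence of the approximations over to the
  -- sources.
  have heq := hu.eq hγ hγ1 hγα' hM fun ℓ => PadicRadial.continuous_of_abs_sub_le (hLip ℓ)
  have hsol : PadicRadial.RadialSolution p α γ M u₀ (PadicRadial.fTilde γ f u) u :=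
    ⟨hγ, hγ1, hγα', PadicRadial.isRadial_fTilde γ f hu.1,
      PadicRadial.powerBound_fTilde hγ hM u, heq⟩
  refine ⟨⟨hu.1, fun t => ⟨PadicRadial.fracIntegral_existsAt hγ.le hγ1 hγα' hsol.radial
    hsol.bound t, heq t⟩⟩, ?_, fun t ht => ?_⟩
  · rw [heq, (PadicRadial.fracIntegral_zero α _).2, add_zero]
  · obtain ⟨h1, h2⟩ := hsol.vladimirov_eq ht
    refine ⟨h1, ?_⟩
    rw [h2, PadicRadial.fTilde, ← mul_assoc, ← Real.rpow_add (norm_pos_iff.2 ht), add_neg_cancel,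
      Real.rpow_zero, one_mul]
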